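/- Let $m\ge 2$, let $F$ be a field equipped with a $\sigma$-algebra for which translations are measurable, let $\mathcal X_1,\dots,\mathcal X_m$ be input alphabets embedded in $F$ and let $\mathcal Z$ be a noise alphabet measurably embedded in $F$. In the additive memoryless $m$-user random access channel there is one receiver for each non-empty set $A\subseteq\{1,\dots,m\}$ of active users, and at time $t$ receiver $A$ observes $$Y_{A,t}=\sum_{a\in A}X_{a,t}+Z_{A,t},$$ where the noise variables $Z_{A,t}$ are mutually independent and all have the same law on $\mathcal Z$. A message structure $\mathscr W$ consists of finitely many messages $W_{i,1},W_{i,2},\dots$ for each user $i$, forming a set $\mathcal W_i$, and of sets $\mathcal W_i(A)\subseteq\mathcal W_i$ for $i\in A$ (the messages of user $i$ that receiver $A$ has to decode) with $\mathcal W_i(B)\subseteq\mathcal W_i(A)$ for $i\in A\subseteq B$. In a code of block length $n$ the messages are independent, independent of the noise, and $W_{i,j}$ is uniform on a set of size $\lceil 2^{nR_{i,j}}\rceil$, $R_{i,j}\ge 0$; encoder $i$ maps the messages of user $i$ to a codeword in $\mathcal X_i^n$, and decoder $A$ (measurable) estimates the messages in $\bigcup_{i\in A}\mathcal W_i(A)$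 from $(Y_{A,1},\dots,Y_{A,n})$. A tuple $(r_i(A))_{i\in A\subseteq\{1,\dots,m\}}$ is achievable for $\mathscr W$ if, for some rates $R_{i,j}\ge0$ with $r_i(A)=\sum_{j:W_{i,j}\in\mathcal W_i(A)}R_{i,j}$, there is a sequence of codes for which the probability that decoder $A$ errs on at least one of its messages tends to $0$ as $n\to\infty$, for every $A$. The capacity region $\mathcal C$ is the closure of the union over all $\mathscr W$ of the closures of the sets of tuples achievable for $\mathscr W$. Let $\mathcal O$ be the set of non-negative tuples with $$r_i(B)\le r_i(A)\qquad\text{for all } i\in A\subseteq B\subseteq\{1,\dots,m\}$$ for which there is a joint distribution $p(q)p(x_1|q)\cdots p(x_m|q)$ of discrete random variables $Q,X_1,\dots,X_m$ with values in $\mathcal Q,\mathcal X_1,\dots,\mathcal X_m$, $|\mathcal Q|\le m!\cdot m$, such that for every ordering $i_1,\dots,i_m$ of $\{1,\dots,m\}$ and every $K\in\{1,\dots,m\}$ $$\sum_{k=1}^K r_{i_k}(\{i_1,\dots,i_k\})\le I(X_{i_1},\dots,X_{i_K};Y_{\{i_1,\dots,i_K\}}\mid Q)\quad\text{and}\quad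 \sum_{k=1}^K r_{i_k}(\{i_1,\dots,i_k\})\le I(X_{i_1},\dots,X_{i_K};Y_{\{i_1,\dots,i_K\}}),$$ with mutual informations in bits; here $Y_A$ is the output of receiver $A$ for the inputs $X_1,\dots,X_m$, its noise being independent of $(Q,X_1,\dots,X_m)$. Then $\mathcal C\subseteq\mathcal O$ if the alphabets $\mathcal X_1,\dots,\mathcal X_m$ are finite, and $\mathcal C\subseteq\overline{\mathcal O}$ (the closure of $\mathcal O$) for arbitrary alphabets. -/

import Mathlib

open MeasureTheory Filter Topology
open scoped ENNReal Nat

noncomputable section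

/-! ### Discrete distributions and mutual information -/

lemma ENNReal.tsum_pi_prod_fin {m : ℕ} {X : Fin m → Type*} (f : ∀ i, X i → ℝ≥0∞) :
    ∑' x : ∀ i, X i, ∏ i, f i (x i) = ∏ i, ∑' a, f i a := by
  induction m with
  | zero => simp
  | succ m ih =>
    rw [← (Fin.consEquiv X).tsum_eq, ENNReal.tsum_prod', Fin.prod_univ_succ]
    simp only [Fin.consEquiv_apply, Fin.prod_univ_succ, Fin.cons_zero, Fin.cons_succ,
      ENNReal.tsum_mul_left, ENNReal.tsum_mul_right]
    rw [ih (fun i => f i.succ)]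

/-- The product distribution `x ↦ p₁(x₁) ⋯ p_m(x_m)`, i.e. the law of independent `X₁, …, X_m`
with `X_i ∼ p_i`. -/
def prodPMF {m : ℕ} {X : Fin m → Type*} (p : ∀ i, PMF (X i)) : PMF (∀ i, X i) :=
  ⟨fun x => ∏ i, p i (x i), by
    rw [Summable.hasSum_iff ENNReal.summable, ENNReal.tsum_pi_prod_fin]
    simp [PMF.tsum_coe]⟩

/-- Mutual information, in bits, between a discrete input `X ∼ p` and the output `Y` of the channel
which has law `W x` when `X = x`:
`I(X; Y) = ∑ₓ p(x) D(P_{Y | X = x} ‖ P_Y)`, where `P_Y = ∑ₓ p(x) W(x)` is the law of `Y`. -/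
def mutualInfo {α β : Type*} [MeasurableSpace β] (p : PMF α) (W : α → Measure β) : ℝ≥0∞ :=
  (∑' x, p x * InformationTheory.klDiv (W x) (Measure.sum fun x' => p x' • W x')) /
    ENNReal.ofReal (Real.log 2)

/-! ### The additive random access channel -/

/-- The receivers: one for each non-empty set `A` of active users. -/
abbrev Receiver (m : ℕ) := {A : Finset (Fin m) // A.Nonempty}

/-- An additive memoryless `m`-user random access channel. User `i` has the input alphabet `X i`,
which is embedded in the field `F`, and the noise alphabet `Z` is (measurably) embedded in `F`.
In each use of the channel receiver `A` observes the element `∑_{a ∈ A} X_a + Z_A` of `F`. The noise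
variables `Z_A` (for all `A` and all times) are independent, and `Z_A` has law `noise A`.

No σ-algebra on the input alphabets is needed: all inputs considered below are discrete. -/
structure AdditiveRAC {m : ℕ} (X : Fin m → Type*) (F Z : Type*)
    [Field F] [MeasurableSpace F] [MeasurableSpace Z] where
  inputEmb : ∀ i, X i ↪ F
  noiseEmb : Z ↪ F
  measurable_noiseEmb : Measurable noiseEmb
  noise : Receiver m → Measure Z
  isProbabilityMeasure_noise : ∀ A, IsProbabilityMeasure (noise A)

/-- A message structure: user `i` has `numMsgs i` messages `W_{i,1}, W_{i,2}, …`, and receiver `A`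
is to decode the messages of user `i ∈ A` whose index belongs to `decoded i A`. The values
`decoded i A` for `i ∉ A` are never used. -/
structure MessageStructure (m : ℕ) where
  numMsgs : Fin m → ℕ
  decoded : ∀ i, Finset (Fin m) → Finset (Fin (numMsgs i))
  decoded_anti : ∀ (i : Fin m) (A B : Finset (Fin m)), i ∈ A → A ⊆ B → decoded i B ⊆ decoded i A

namespace MessageStructure

variable {m : ℕ} (𝓦 : MessageStructure m)

/-- The indices `(i, j)` of the messages that receiver `A` has to decode. -/
abbrev Target (A : Finset (Fin m)) : Type :=
  {p : Σ i, Fin (𝓦.numMsgs i) // p.1 ∈ A ∧ p.2 ∈ 𝓦.decoded p.1 A}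

/-- The coding rates `R_{i,j}` of the individual messages. -/
abbrev Rates : Type := ∀ i, Fin (𝓦.numMsgs i) → ℝ

end MessageStructure

/-- The size `⌈2^{nR}⌉` of the set in which a message of rate `R` takes its values. -/
def msgCard (n : ℕ) (R : ℝ) : ℕ := ⌈(2 : ℝ) ^ ((n : ℝ) * R)⌉₊

/-- A tuple `{r_i(A)}` of rates, indexed by the `m 2^{m-1}` pairs `(i, A)` with `i ∈ A`. -/
abbrev RateTuple (m : ℕ) : Type := {p : Fin m × Finset (Fin m) // p.1 ∈ p.2} → ℝ

namespace AdditiveRAC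

variable {m : ℕ} {X : Fin m → Type*} {F Z : Type*}
  [Field F] [MeasurableSpace F] [MeasurableSpace Z]

/-- The symbol received by receiver `A`, when the users in `A` send `x` and the noise is `z`. -/
def output (ch : AdditiveRAC X F Z) (A : Receiver m) (x : ∀ i : A.1, X i) (z : Z) : F :=
  ∑ i : A.1, ch.inputEmb i (x i) + ch.noiseEmb z

/-- The law of the symbol received by receiver `A` when the users in `A` send `x`. -/
def outputLaw (ch : AdditiveRAC X F Z) (A : Receiver m) (x : ∀ i : A.1, X i) : Measure F :=
  (ch.noise A).map (ch.output A x)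

/-- The law of all noise symbols `Z_{A,t}` in `n` uses of the channel. -/
def noiseLaw (ch : AdditiveRAC X F Z) (n : ℕ) : Measure (Fin n → Receiver m → Z) :=
  Measure.pi fun _ => Measure.pi ch.noise

end AdditiveRAC

/-- A code of block length `n` for the message structure `𝓦` and the message rates `R`, for a channel
with input alphabets `X i` and output alphabet `F`: one encoder for each user, which knows the
messages of that user only, and one decoder for each receiver, which gives an estimate of every
message that the receiver has to decode. -/
structure RACCode {m : ℕ} (X : Fin m → Type*) (F : Type*) [MeasurableSpace F]
    (𝓦 : MessageStructure m) (R : 𝓦.Rates) (n : ℕ) where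
  enc : ∀ i, (∀ j, Fin (msgCard n (R i j))) → Fin n → X i
  dec : ∀ A : Receiver m, (Fin n → F) → ∀ p : 𝓦.Target A.1, Fin (msgCard n (R p.1.1 p.1.2))
  measurable_dec : ∀ A, Measurable (dec A)

namespace AdditiveRAC

variable {m : ℕ} {X : Fin m → Type*} {F Z : Type*}
  [Field F] [MeasurableSpace F] [MeasurableSpace Z]

/-- The sequence observed by receiver `A` when the messages are `w` and the noise is `z`. -/
def received (ch : AdditiveRAC X F Z) {𝓦 : MessageStructure m} {R : 𝓦.Rates} {n : ℕ}
    (c : RACCode X F 𝓦 R n) (A : Receiver m) (w : ∀ i j, Fin (msgCard n (R i j)))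
    (z : Fin n → Receiver m → Z) : Fin n → F :=
  fun t => ch.output A (fun i => c.enc i (w i) t) (z t A)

/-- The average probability that receiver `A` estimates at least one of its messages wrongly, when
all messages are independent and uniformly distributed, and independent of the noise. -/
def errorProb (ch : AdditiveRAC X F Z) {𝓦 : MessageStructure m} {R : 𝓦.Rates} {n : ℕ}
    (c : RACCode X F 𝓦 R n) (A : Receiver m) : ℝ :=
  (∑ w : ∀ i j, Fin (msgCard n (R i j)),
      (ch.noiseLaw n).real {z | ∃ p : 𝓦.Target A.1,
        c.dec A (ch.received c A w z) p ≠ w p.1.1 p.1.2}) /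
    Fintype.card (∀ i j, Fin (msgCard n (R i j)))

/-- The rate tuples that are achievable for the message structure `𝓦`: the tuples
`r_i(A) = ∑_{j ∈ decoded i A} R_{i,j}`, for non-negative message rates `R_{i,j}` such that some
sequence of codes of block length `n` has error probabilities vanishing at all the receivers. -/
def achievable (ch : AdditiveRAC X F Z) (𝓦 : MessageStructure m) : Set (RateTuple m) :=
  {r | ∃ R : 𝓦.Rates, (∀ i j, 0 ≤ R i j) ∧
    (∀ p, r p = ∑ j ∈ 𝓦.decoded p.1.1 p.1.2, R p.1.1 j) ∧
    ∃ c : ∀ n, RACCode X F 𝓦 R n, ∀ A, Tendsto (fun n => ch.errorProb (c n) A) atTop (𝓝 0)}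

/-- The capacity region for the message structure `𝓦`. -/
def capacityRegionFor (ch : AdditiveRAC X F Z) (𝓦 : MessageStructure m) : Set (RateTuple m) :=
  closure (ch.achievable 𝓦)

/-- The capacity region of the channel. -/
def capacityRegion (ch : AdditiveRAC X F Z) : Set (RateTuple m) :=
  closure (⋃ 𝓦 : MessageStructure m, ch.capacityRegionFor 𝓦)

/-! ### The outer bound -/

/-- `I(X_A; Y_A)`, in bits, when the vector `(X₁, …, X_m)` of all the inputs has law `p`. -/
def inputOutputInfo (ch : AdditiveRAC X F Z) (p : PMF (∀ i, X i)) (A : Receiver m) : ℝ≥0∞ :=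
  mutualInfo (p.map fun x (i : A.1) => x i) (ch.outputLaw A)

/-- `I(X_A; Y_A | Q)`, in bits, for the joint law `p(q) p(x₁ | q) ⋯ p(x_m | q)`. -/
def condInputOutputInfo (ch : AdditiveRAC X F Z) {N : ℕ} (pQ : PMF (Fin N))
    (pX : Fin N → ∀ i, PMF (X i)) (A : Receiver m) : ℝ≥0∞ :=
  ∑ q, pQ q * ch.inputOutputInfo (prodPMF (pX q)) A

end AdditiveRAC

/-- The set `{i₁, …, i_k}` of the first users of the ordering `i₁, …, i_m` that is given by the
permutation `σ`, up to and including the user `i_k = σ k`. -/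
def firstUsers {m : ℕ} (σ : Equiv.Perm (Fin m)) (k : Fin m) : Receiver m :=
  ⟨(Finset.Iic k).map σ.toEmbedding, ⟨σ k, by simp⟩⟩

lemma mem_firstUsers {m : ℕ} (σ : Equiv.Perm (Fin m)) (k : Fin m) :
    σ k ∈ (firstUsers σ k).1 := by
  simp [firstUsers]

namespace AdditiveRAC

variable {m : ℕ} {X : Fin m → Type*} {F Z : Type*}
  [Field F] [MeasurableSpace F] [MeasurableSpace Z]

/-- The non-negative rate tuples with `r_i(B) ≤ r_i(A)` for `i ∈ A ⊆ B` for which there is a joint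
distribution `p(q) p(x₁ | q) ⋯ p(x_m | q)` with `|Q| ≤ m! m` such that, for all orderings
`i₁, …, i_m` of the users and all `K`,
`∑_{k ≤ K} r_{i_k}({i₁, …, i_k}) ≤ I(X_{i₁}, …, X_{i_K}; Y_{i₁ … i_K} | Q)`, and likewise with the
unconditional mutual information, in which `(X₁, …, X_m)` has the law `∑_q p(q) p(x₁ | q) ⋯ p(x_m | q)`. -/
def outerRegion (ch : AdditiveRAC X F Z) : Set (RateTuple m) :=
  {r | (∀ p, 0 ≤ r p) ∧
    (∀ (i : Fin m) (A B : Finset (Fin m)) (hA : i ∈ A) (hAB : A ⊆ B),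
      r ⟨(i, B), hAB hA⟩ ≤ r ⟨(i, A), hA⟩) ∧
    ∃ N : ℕ, N ≤ m ! * m ∧ ∃ (pQ : PMF (Fin N)) (pX : Fin N → ∀ i, PMF (X i)),
      ∀ (σ : Equiv.Perm (Fin m)) (K : Fin m),
        ENNReal.ofReal (∑ k ∈ Finset.Iic K, r ⟨(σ k, (firstUsers σ k).1), mem_firstUsers σ k⟩) ≤
            ch.condInputOutputInfo pQ pX (firstUsers σ K) ∧
        ENNReal.ofReal (∑ k ∈ Finset.Iic K, r ⟨(σ k, (firstUsers σ k).1), mem_firstUsers σ k⟩) ≤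
            ch.inputOutputInfo (pQ.bind fun q => prodPMF (pX q)) (firstUsers σ K)}

end AdditiveRAC

end

/-! Fix a code and regard a whole block as one additive channel on `F^n` whose inputs are the
messages. Once the message of user `i ∉ A` is known, the output of receiver `A ∪ {i}` is a translate
of an output with the law seen by receiver `A`, because all receivers have the same noise law.
Divergence is invariant under translation, so the block information `I(A)` between the messages of
the users in `A` and the output of receiver `A` satisfies the exact chain rule `I(A ∪ {i}) = I(A) +
I(W_i; Y_{A ∪ {i}})` (`mutualInfoNats_macLaw_insert`). Receiver `A ∪ {i}` decodes messages of user
`i` of total rate `r_i(A ∪ {i})`, so Fano's inequality (`fano_macLaw`) bounds the last term below by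
about `n r_i(A ∪ {i})` bits. Adding users in the order `i_1, i_2, …` makes the sum telescope
(`sum_Iic_le_of_insert`): each step uses a different receiver, yet only the information at the last
one remains.

The block information is at most the sum of the single-letter informations
(`mutualInfoNats_macLaw_pi_le`). Their average over time is a conditional information given a
time-sharing variable, and Carathéodory's theorem in the space of real functions on the `2^m - 1`
receivers leaves at most `2^m ≤ m! m` values of it (`exists_timeSharing`). The unconditional bound
follows from the conditional one by concavity of mutual information in the input law.

Hence slightly reduced rates lie in the outer region, and letting `n → ∞` gives its closure. For
finite alphabets mutual information is continuous in the input law and the laws range over a compact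
set, so the outer region is already closed.

Most information identities reduce to the compensation identity `sum_mul_klDiv_eq`, which holds for
arbitrary output spaces and finitely many inputs. Encoders have finitely many messages, so infinite
input alphabets are handled through push-forwards of message laws. -/

open InformationTheory ProbabilityTheory

/-! ### Kullback-Leibler divergence -/

section KullbackLeibler

variable {α β : Type*} [MeasurableSpace α] [MeasurableSpace β]

lemma klDiv_map_measurableEquiv (μ ν : Measure α) [IsFiniteMeasure μ] [IsFiniteMeasure ν]
    (e : α ≃ᵐ β) : klDiv (μ.map e) (ν.map e) = klDiv μ ν := by
  refine le_antisymm (klDiv_map_le μ ν e.measurable) ?_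
  have h := klDiv_map_le (μ.map e) (ν.map e) e.symm.measurable
  rwa [MeasurableEquiv.map_symm_map, MeasurableEquiv.map_symm_map] at h

lemma klDiv_prod (μ₁ ν₁ : Measure α) (μ₂ ν₂ : Measure β) [IsProbabilityMeasure μ₁]
    [IsProbabilityMeasure ν₁] [IsProbabilityMeasure μ₂] [IsProbabilityMeasure ν₂] :
    klDiv (μ₁.prod μ₂) (ν₁.prod ν₂) = klDiv μ₁ ν₁ + klDiv μ₂ ν₂ := by
  rw [← Measure.compProd_const, ← Measure.compProd_const, klDiv_compProd_eq_add]
  congr 1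
  rw [Measure.compProd_const, Measure.compProd_const, ← klDiv_map_measurableEquiv _ _
    MeasurableEquiv.prodComm]
  simp only [MeasurableEquiv.prodComm, MeasurableEquiv.coe_mk, Equiv.coe_prodComm]
  rw [Measure.prod_swap, Measure.prod_swap, ← Measure.compProd_const, ← Measure.compProd_const,
    klDiv_compProd_left]

lemma klDiv_pi {n : ℕ} (μ ν : Fin n → Measure α) [∀ t, IsProbabilityMeasure (μ t)]
    [∀ t, IsProbabilityMeasure (ν t)] :
    klDiv (Measure.pi μ) (Measure.pi ν) = ∑ t, klDiv (μ t) (ν t) := by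
  induction n with
  | zero =>
    rw [Measure.pi_of_empty μ, Measure.pi_of_empty ν]
    simp
  | succ n ih =>
    rw [Fin.sum_univ_succ, ← ih (fun t => μ t.succ) (fun t => ν t.succ), ← klDiv_prod,
      ← klDiv_map_measurableEquiv _ _ (MeasurableEquiv.piFinSuccAbove (fun _ => α) 0),
      (measurePreserving_piFinSuccAbove μ 0).map_eq, (measurePreserving_piFinSuccAbove ν 0).map_eq]
    simp

lemma rnDeriv_le_of_le_smul {μ ν : Measure α} [IsFiniteMeasure ν] {c : ℝ≥0∞}
    (h : μ ≤ c • ν) : μ.rnDeriv ν ≤ᵐ[ν] fun _ => c := by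
  refine ae_le_of_forall_setLIntegral_le_of_sigmaFinite (Measure.measurable_rnDeriv _ _)
    fun s hs _ => ?_
  calc ∫⁻ x in s, μ.rnDeriv ν x ∂ν ≤ μ s := Measure.setLIntegral_rnDeriv_le s
    _ ≤ (c • ν) s := h s
    _ = ∫⁻ _ in s, c ∂ν := by simp

lemma exists_klFun_le (C : ℝ) : ∃ B, ∀ x ∈ Set.Icc 0 C, |klFun x| ≤ B :=
  (isCompact_Icc.exists_bound_of_continuousOn continuous_klFun.continuousOn)

/-- The density is bounded by `c`, and `klFun` is bounded on `[0, c]`. This makes every information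
with a finite input set finite. -/
lemma klDiv_ne_top_of_le_smul {μ ν : Measure α} [IsFiniteMeasure μ] [IsFiniteMeasure ν]
    {c : ℝ≥0∞} (hc : c ≠ ∞) (h : μ ≤ c • ν) : klDiv μ ν ≠ ∞ := by
  have hac : μ ≪ ν := (Measure.absolutelyContinuous_of_le h).trans
    (Measure.smul_absolutelyContinuous)
  rw [klDiv_eq_lintegral_klFun_of_ac hac]
  obtain ⟨B, hB⟩ := exists_klFun_le c.toReal
  refine ne_top_of_le_ne_top (b := ∫⁻ _, ENNReal.ofReal B ∂ν) ?_ (lintegral_mono_ae ?_)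
  · simp [ENNReal.mul_eq_top]
  · filter_upwards [rnDeriv_le_of_le_smul h] with x hx
    exact ENNReal.ofReal_le_ofReal ((le_abs_self _).trans
      (hB _ ⟨ENNReal.toReal_nonneg, ENNReal.toReal_mono hc hx⟩))

/-- Young's inequality: `exp a - 1` is the convex conjugate of `klFun`. -/
lemma mul_sub_exp_le_klFun {t : ℝ} (ht : 0 ≤ t) (a : ℝ) : a * t - (Real.exp a - 1) ≤ klFun t := by
  rcases ht.eq_or_lt with rfl | ht
  · simp [klFun, (Real.exp_pos a).le]
  · have h1 := Real.add_one_le_exp (a - Real.log t)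
    rw [Real.exp_sub, Real.exp_log ht, le_div_iff₀ ht] at h1
    rw [klFun]; linarith

/-- A variational lower bound for the divergence, with a function that is constant on `s` and
on its complement. -/
lemma le_toReal_klDiv_of_set {μ ν : Measure α} [IsProbabilityMeasure μ] [IsProbabilityMeasure ν]
    (h : klDiv μ ν ≠ ∞) {s : Set α} (hs : MeasurableSet s) (a b : ℝ) :
    a * μ.real s + b * μ.real sᶜ - (Real.exp a * ν.real s + Real.exp b * ν.real sᶜ - 1) ≤
      (klDiv μ ν).toReal := by
  obtain ⟨hac, hint⟩ := klDiv_ne_top_iff.1 h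
  rw [toReal_klDiv_eq_integral_klFun hac]
  have hi : Integrable (fun x => klFun (μ.rnDeriv ν x).toReal) ν :=
    (integrable_klFun_rnDeriv_iff hac).2 hint
  have key : ∀ (c : ℝ) (u : Set α), c * μ.real u - (Real.exp c - 1) * ν.real u ≤
      ∫ x in u, klFun (μ.rnDeriv ν x).toReal ∂ν := by
    intro c u
    rw [← Measure.setIntegral_toReal_rnDeriv hac, ← integral_const_mul]
    have : (Real.exp c - 1) * ν.real u = ∫ _ in u, (Real.exp c - 1) ∂ν := by simp [mul_comm]
    rw [this, ← integral_sub (Measure.integrable_toReal_rnDeriv.integrableOn.const_mul c)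
      (integrable_const _)]
    exact integral_mono ((Measure.integrable_toReal_rnDeriv.integrableOn.const_mul c).sub
      (integrable_const _)) hi.integrableOn
      fun x => mul_sub_exp_le_klFun ENNReal.toReal_nonneg c
  rw [← integral_add_compl hs hi]
  have h1 := key a s
  have h2 := key b sᶜ
  have h3 : ν.real sᶜ = 1 - ν.real s := probReal_compl_eq_one_sub hs
  rw [h3] at h2 ⊢
  linarith

/-- The core of Fano's inequality, from the test function with `exp f = M / 2` on `s` and `1 / 2`
off `s`. If `ν s ≤ 1 / M`, the correction term helps and the only loss is `log 2`. -/
lemma mul_log_sub_le_toReal_klDiv {μ ν : Measure α} [IsProbabilityMeasure μ]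
    [IsProbabilityMeasure ν] (h : klDiv μ ν ≠ ∞) {s : Set α} (hs : MeasurableSet s) {M : ℝ}
    (hM : 0 < M) :
    μ.real s * Real.log M - Real.log 2 - (M * ν.real s - 1) / 2 ≤ (klDiv μ ν).toReal := by
  have h1 := le_toReal_klDiv_of_set h hs (Real.log M - Real.log 2) (-Real.log 2)
  rw [Real.exp_sub, Real.exp_log hM, Real.exp_neg, Real.exp_log two_pos,
    probReal_compl_eq_one_sub hs, probReal_compl_eq_one_sub hs] at h1
  nlinarith [measureReal_nonneg (μ := ν) (s := s)]

end KullbackLeibler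

/-! ### Mixtures and mutual information -/

section Mixture

variable {α β γ : Type*} [MeasurableSpace β]

/-- The law of the output of the channel `W` with input law `p`. -/
noncomputable def PMF.mixture (p : PMF α) (W : α → Measure β) : Measure β :=
  Measure.sum fun x => p x • W x

/-- The mutual information in nats between input and output of the channel `W` with input law `p`. -/
noncomputable def mutualInfoNats (p : PMF α) (W : α → Measure β) : ℝ≥0∞ :=
  ∑' x, p x * klDiv (W x) (p.mixture W)

lemma mutualInfo_eq_div (p : PMF α) (W : α → Measure β) :
    mutualInfo p W = mutualInfoNats p W / ENNReal.ofReal (Real.log 2) := rfl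

lemma PMF.tsum_map_mul (p : PMF α) (f : α → γ) (g : γ → ℝ≥0∞) :
    ∑' b, p.map f b * g b = ∑' a, p a * g (f a) := by
  classical
  simp_rw [PMF.map_apply, ← ENNReal.tsum_mul_right]
  rw [ENNReal.tsum_comm]
  refine tsum_congr fun a => ?_
  rw [tsum_eq_single (f a)]
  · simp
  · intro b hb; simp [hb]

lemma PMF.mixture_apply (p : PMF α) (W : α → Measure β) {s : Set β} (hs : MeasurableSet s) :
    p.mixture W s = ∑' x, p x * W x s := by
  rw [PMF.mixture, Measure.sum_apply _ hs]; rfl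

lemma PMF.mixture_map (p : PMF α) (f : α → γ) (W : γ → Measure β) :
    (p.map f).mixture W = p.mixture (W ∘ f) := by
  ext s hs
  rw [PMF.mixture_apply _ _ hs, PMF.mixture_apply _ _ hs,
    p.tsum_map_mul f fun b => W b s]
  rfl

lemma mutualInfoNats_map (p : PMF α) (f : α → γ) (W : γ → Measure β) :
    mutualInfoNats (p.map f) W = mutualInfoNats p (W ∘ f) := by
  rw [mutualInfoNats, mutualInfoNats, PMF.mixture_map,
    p.tsum_map_mul f fun b => klDiv (W b) _]
  rfl

lemma mutualInfo_map (p : PMF α) (f : α → γ) (W : γ → Measure β) :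
    mutualInfo (p.map f) W = mutualInfo p (W ∘ f) := by
  rw [mutualInfo_eq_div, mutualInfo_eq_div, mutualInfoNats_map]

instance PMF.isProbabilityMeasure_mixture (p : PMF α) (W : α → Measure β)
    [∀ x, IsProbabilityMeasure (W x)] : IsProbabilityMeasure (p.mixture W) :=
  ⟨by simp [PMF.mixture_apply, PMF.tsum_coe]⟩

/-- The mixture contains `p x • W x` as one of its summands. -/
lemma PMF.le_smul_mixture (p : PMF α) (W : α → Measure β) {x : α} (hx : p x ≠ 0) :
    W x ≤ (p x)⁻¹ • p.mixture W := by
  refine Measure.le_iff.2 fun s hs => ?_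
  have h := ENNReal.le_tsum (f := fun x => p x * W x s) x
  rw [← PMF.mixture_apply _ _ hs] at h
  calc W x s = (p x)⁻¹ * (p x * W x s) := by
        rw [← mul_assoc, ENNReal.inv_mul_cancel hx (p.apply_ne_top x), one_mul]
    _ ≤ _ := by simpa using mul_le_mul_right h _

lemma PMF.absolutelyContinuous_mixture (p : PMF α) (W : α → Measure β) {x : α} (hx : p x ≠ 0) :
    W x ≪ p.mixture W :=
  (Measure.absolutelyContinuous_of_le (p.le_smul_mixture W hx)).trans
    Measure.smul_absolutelyContinuous

lemma klDiv_mixture_ne_top (p : PMF α) (W : α → Measure β) [∀ x, IsProbabilityMeasure (W x)]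
    {x : α} (hx : p x ≠ 0) : klDiv (W x) (p.mixture W) ≠ ∞ :=
  klDiv_ne_top_of_le_smul (ENNReal.inv_ne_top.2 hx) (p.le_smul_mixture W hx)

lemma mutualInfoNats_ne_top [Fintype α] (p : PMF α) (W : α → Measure β)
    [∀ x, IsProbabilityMeasure (W x)] : mutualInfoNats p W ≠ ∞ := by
  rw [mutualInfoNats, tsum_fintype]
  refine ENNReal.sum_ne_top.2 fun x _ => ?_
  by_cases hx : p x = 0
  · simp [hx]
  · exact ENNReal.mul_ne_top (p.apply_ne_top x) (klDiv_mixture_ne_top p W hx)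

lemma PMF.mixture_eq_withDensity [Fintype α] (p : PMF α) (W : α → Measure β) (Q : Measure β)
    [SigmaFinite Q] [∀ x, IsProbabilityMeasure (W x)] (h : ∀ x, p x ≠ 0 → W x ≪ Q) :
    p.mixture W = Q.withDensity fun y => ∑ x, p x * (W x).rnDeriv Q y := by
  ext s hs
  rw [PMF.mixture_apply _ _ hs, withDensity_apply _ hs, tsum_fintype, lintegral_finsetSum]
  · refine Finset.sum_congr rfl fun x _ => ?_
    rw [lintegral_const_mul _ (Measure.measurable_rnDeriv _ _)]
    by_cases hx : p x = 0
    · simp [hx]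
    · rw [Measure.setLIntegral_rnDeriv (h x hx)]
  · intro x _
    exact (Measure.measurable_rnDeriv _ _).const_mul _

lemma PMF.rnDeriv_mixture [Fintype α] (p : PMF α) (W : α → Measure β) (Q : Measure β)
    [SigmaFinite Q] [∀ x, IsProbabilityMeasure (W x)] (h : ∀ x, p x ≠ 0 → W x ≪ Q) :
    (p.mixture W).rnDeriv Q =ᵐ[Q] fun y => ∑ x, p x * (W x).rnDeriv Q y := by
  rw [p.mixture_eq_withDensity W Q h]
  exact Measure.rnDeriv_withDensity _ (Finset.measurable_fun_sum _ fun x _ =>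
    (Measure.measurable_rnDeriv _ _).const_mul _)

lemma klFun_mul_eq {a b : ℝ} (hb : b ≠ 0) :
    klFun (a * b) = b * klFun a + a * (b * Real.log b) + (1 - b) := by
  by_cases ha : a = 0
  · simp [ha, klFun]
  · rw [klFun, klFun, Real.log_mul ha hb]; ring

/-- Pointwise form of the compensation identity: `a x` stands for the density of `W x` with respect
to the mixture and `b` for that of the mixture with respect to `Q`. -/
lemma sum_mul_klFun_mul [Fintype α] (p a : α → ℝ) (b : ℝ) (hp : ∑ x, p x = 1)
    (hab : ∑ x, p x * (a x * b) = b) :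
    ∑ x, p x * klFun (a x * b) = (∑ x, p x * (b * klFun (a x))) + klFun b := by
  by_cases hb : b = 0
  · simp [hb, klFun, hp]
  have ha : ∑ x, p x * a x = 1 := by
    have : (∑ x, p x * a x) * b = 1 * b := by
      rw [Finset.sum_mul, one_mul]; simpa only [mul_assoc] using hab
    exact mul_right_cancel₀ hb this
  simp only [klFun_mul_eq hb, mul_add, Finset.sum_add_distrib]
  rw [add_assoc]
  congr 1
  simp only [← mul_assoc, ← Finset.sum_mul, ha, hp]
  rw [klFun]; ring

lemma PMF.sum_toReal [Fintype α] (p : PMF α) : ∑ x, (p x).toReal = 1 := by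
  rw [← ENNReal.toReal_sum fun x _ => p.apply_ne_top x, ← tsum_fintype (L := .unconditional _), p.tsum_coe,
    ENNReal.toReal_one]

/-- The compensation identity. -/
lemma sum_mul_klDiv_eq [Fintype α] (p : PMF α) (W : α → Measure β) (Q : Measure β)
    [∀ x, IsProbabilityMeasure (W x)] [IsProbabilityMeasure Q] :
    ∑ x, p x * klDiv (W x) Q = mutualInfoNats p W + klDiv (p.mixture W) Q := by
  -- If some input of positive probability violates absolute continuity, both sides are infinite.
  -- Otherwise all terms become integrals against `Q`, and the integrands agree almost everywhere.
  by_cases h : ∀ x, p x ≠ 0 → W x ≪ Q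
  swap
  · push Not at h
    obtain ⟨x, hx, hac⟩ := h
    have h1 : klDiv (p.mixture W) Q = ∞ :=
      klDiv_of_not_ac fun h => hac ((p.absolutelyContinuous_mixture W hx).trans h)
    rw [h1, add_top, ENNReal.sum_eq_top]
    exact ⟨x, Finset.mem_univ _, by rw [klDiv_of_not_ac hac, ENNReal.mul_top hx]⟩
  set P := p.mixture W with hP
  have hPQ : P ≪ Q := by
    rw [hP, p.mixture_eq_withDensity W Q h]; exact withDensity_absolutelyContinuous _ _
  rw [mutualInfoNats, tsum_fintype, ← hP]
  have hl : ∀ x, p x * klDiv (W x) Q =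
      ∫⁻ y, p x * ENNReal.ofReal (klFun ((W x).rnDeriv Q y).toReal) ∂Q := by
    intro x
    by_cases hx : p x = 0
    · simp [hx]
    rw [klDiv_eq_lintegral_klFun_of_ac (h x hx), lintegral_const_mul' _ _ (p.apply_ne_top x)]
  have hr : ∀ x, p x * klDiv (W x) P =
      ∫⁻ y, p x * (P.rnDeriv Q y * ENNReal.ofReal (klFun ((W x).rnDeriv P y).toReal)) ∂Q := by
    intro x
    by_cases hx : p x = 0
    · simp [hx]
    rw [klDiv_eq_lintegral_klFun_of_ac (p.absolutelyContinuous_mixture W hx),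
      lintegral_const_mul' _ _ (p.apply_ne_top x), lintegral_rnDeriv_mul hPQ]
    fun_prop
  simp only [hl, hr]
  rw [klDiv_eq_lintegral_klFun_of_ac hPQ, ← lintegral_finsetSum, ← lintegral_finsetSum,
    ← lintegral_add_right]
  rotate_left
  · fun_prop
  · intro x _; fun_prop
  · intro x _; fun_prop
  refine lintegral_congr_ae ?_
  have h1 : ∀ᵐ y ∂Q, ∀ x, p x ≠ 0 →
      (W x).rnDeriv P y * P.rnDeriv Q y = (W x).rnDeriv Q y := by
    refine ae_all_iff.2 fun x => ?_
    by_cases hx : p x = 0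
    · simp [hx]
    filter_upwards [Measure.rnDeriv_mul_rnDeriv (κ := Q)
      (p.absolutelyContinuous_mixture W hx)] with y hy _ using hy
  have h2 : ∀ᵐ y ∂Q, ∀ x, (W x).rnDeriv Q y < ∞ :=
    ae_all_iff.2 fun x => Measure.rnDeriv_lt_top _ _
  filter_upwards [h1, h2, p.rnDeriv_mixture W Q h, Measure.rnDeriv_lt_top P Q] with y h1 h2 h3 h4
  have hfin : ∀ x, p x * ENNReal.ofReal (klFun ((W x).rnDeriv Q y).toReal) =
      ENNReal.ofReal ((p x).toReal * klFun (((W x).rnDeriv P y).toReal * (P.rnDeriv Q y).toReal)) := by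
    intro x
    by_cases hx : p x = 0
    · simp [hx]
    rw [ENNReal.ofReal_mul ENNReal.toReal_nonneg, ENNReal.ofReal_toReal (p.apply_ne_top x),
      ← h1 x hx, ENNReal.toReal_mul]
  have hfin' : ∀ x, p x * (P.rnDeriv Q y * ENNReal.ofReal (klFun ((W x).rnDeriv P y).toReal)) =
      ENNReal.ofReal ((p x).toReal * ((P.rnDeriv Q y).toReal * klFun ((W x).rnDeriv P y).toReal)) := by
    intro x
    rw [ENNReal.ofReal_mul ENNReal.toReal_nonneg, ENNReal.ofReal_toReal (p.apply_ne_top x),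
      ENNReal.ofReal_mul ENNReal.toReal_nonneg, ENNReal.ofReal_toReal h4.ne]
  have nn : ∀ t : ℝ≥0∞, 0 ≤ klFun t.toReal := fun t => klFun_nonneg ENNReal.toReal_nonneg
  simp only [hfin, hfin']
  rw [← ENNReal.ofReal_sum_of_nonneg, ← ENNReal.ofReal_sum_of_nonneg, ← ENNReal.ofReal_add]
  · rw [sum_mul_klFun_mul _ _ _ p.sum_toReal]
    have h5 : (P.rnDeriv Q y).toReal = ∑ x, (p x).toReal * ((W x).rnDeriv Q y).toReal := by
      rw [← hP] at h3
      rw [h3, ENNReal.toReal_sum]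
      · simp
      · intro x _; exact ENNReal.mul_ne_top (p.apply_ne_top x) (h2 x).ne
    conv_rhs => rw [h5]
    refine Finset.sum_congr rfl fun x _ => ?_
    by_cases hx : p x = 0
    · simp [hx]
    rw [← h1 x hx, ENNReal.toReal_mul]
  · exact Finset.sum_nonneg fun x _ => mul_nonneg ENNReal.toReal_nonneg
      (mul_nonneg ENNReal.toReal_nonneg (nn _))
  · exact nn _
  · exact fun x _ => mul_nonneg ENNReal.toReal_nonneg (mul_nonneg ENNReal.toReal_nonneg (nn _))
  · intro x _
    refine mul_nonneg ENNReal.toReal_nonneg ?_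
    rw [← ENNReal.toReal_mul]; exact nn _

lemma mutualInfoNats_le_sum_klDiv [Fintype α] (p : PMF α) (W : α → Measure β) (Q : Measure β)
    [∀ x, IsProbabilityMeasure (W x)] [IsProbabilityMeasure Q] :
    mutualInfoNats p W ≤ ∑ x, p x * klDiv (W x) Q := by
  rw [sum_mul_klDiv_eq]; exact le_self_add

end Mixture

/-! ### Concavity of mutual information in the input law -/

section Concavity

variable {α β ι : Type*} [MeasurableSpace β]

lemma PMF.tsum_bind_mul (q : PMF ι) (p : ι → PMF α) (f : α → ℝ≥0∞) :
    ∑' x, q.bind p x * f x = ∑' i, q i * ∑' x, p i x * f x := by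
  simp_rw [PMF.bind_apply, ← ENNReal.tsum_mul_right, ← ENNReal.tsum_mul_left]
  rw [ENNReal.tsum_comm]
  simp only [mul_assoc]

/-- Mutual information is concave in the input law. -/
lemma tsum_mul_mutualInfoNats_le {κ : ι → Type*} [∀ i, Fintype (κ i)] (q : PMF ι)
    (P : ∀ i, PMF (κ i)) (g : ∀ i, κ i → α) (W : α → Measure β)
    [∀ x, IsProbabilityMeasure (W x)] :
    ∑' i, q i * mutualInfoNats ((P i).map (g i)) W ≤
      mutualInfoNats (q.bind fun i => (P i).map (g i)) W := by
  conv_rhs => rw [mutualInfoNats, PMF.tsum_bind_mul]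
  -- The output law of the overall mixture serves as reference for each component; by the
  -- compensation identity this can only increase the average divergence.
  refine ENNReal.tsum_le_tsum fun i => mul_le_mul_right ?_ _
  rw [mutualInfoNats_map, PMF.tsum_map_mul _ _ fun x => klDiv (W x) _]
  have : ∀ x, IsProbabilityMeasure ((W ∘ g i) x) := fun x => inferInstanceAs
    (IsProbabilityMeasure (W (g i x)))
  exact (mutualInfoNats_le_sum_klDiv _ _ _).trans_eq (tsum_fintype _).symm

end Concavity

/-! ### Independent inputs and resampling of one coordinate -/

section ProductInput

variable {m : ℕ} {M : Fin m → Type*}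

lemma prodPMF_apply (p : ∀ i, PMF (M i)) (w : ∀ i, M i) : prodPMF p w = ∏ i, p i (w i) := rfl

lemma prodPMF_map {X : Fin m → Type*} (p : ∀ i, PMF (M i)) (f : ∀ i, M i → X i) :
    prodPMF (fun i => (p i).map (f i)) = (prodPMF p).map fun w i => f i (w i) := by
  classical
  ext x
  rw [prodPMF_apply, PMF.map_apply]
  simp_rw [PMF.map_apply]
  rw [← ENNReal.tsum_pi_prod_fin]
  refine tsum_congr fun w => ?_
  rw [prodPMF_apply]
  split_ifs with h
  · subst h; simp
  · obtain ⟨i, hi⟩ := Function.ne_iff.1 h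
    exact Finset.prod_eq_zero (Finset.mem_univ i) (by simp [hi])

/-- Swapping the `i`-th coordinate of `w` with `a`. -/
def swapCoord (i : Fin m) : M i × (∀ j, M j) ≃ M i × (∀ j, M j) :=
  Function.Involutive.toPerm (fun v => (v.2 i, Function.update v.2 i v.1)) fun v => by
    ext j <;> simp

lemma swapCoord_apply (i : Fin m) (v : M i × (∀ j, M j)) :
    swapCoord i v = (v.2 i, Function.update v.2 i v.1) := rfl

/-- Exchanging coordinate `i` with an independent copy preserves the product law. This is how one
conditions on the message of user `i`. -/
lemma prodPMF_tsum_update (p : ∀ i, PMF (M i)) (i : Fin m) (g : (∀ i, M i) → ℝ≥0∞) :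
    ∑' a, p i a * ∑' w, prodPMF p w * g (Function.update w i a) = ∑' w, prodPMF p w * g w := by
  simp_rw [← ENNReal.tsum_mul_left]
  rw [← ENNReal.tsum_prod, ← (swapCoord i).tsum_eq, ENNReal.tsum_prod', ENNReal.tsum_comm]
  refine tsum_congr fun w => ?_
  have h : ∀ a, p i (w i) * (prodPMF p (Function.update w i a) * g w) =
      p i a * (prodPMF p w * g w) := by
    intro a
    rw [← mul_assoc, ← mul_assoc]
    congr 1
    rw [prodPMF_apply, prodPMF_apply, ← Finset.mul_prod_erase _ _ (Finset.mem_univ i),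
      ← Finset.mul_prod_erase _ (fun j => p j (w j)) (Finset.mem_univ i), Function.update_self]
    rw [Finset.prod_congr rfl fun j hj => by rw [Function.update_of_ne (Finset.ne_of_mem_erase hj)]]
    ring
  simp [swapCoord_apply, h, ENNReal.tsum_mul_right, PMF.tsum_coe]

end ProductInput

/-! ### The additive multiple-access channel -/

section AdditiveMAC

variable {m : ℕ} {M : Fin m → Type*} {G : Type*} [AddCommGroup G] [MeasurableSpace G]

/-- The law of `∑_{i ∈ A} x_i(w_i)` plus noise of law `ρ`. -/
noncomputable def macLaw (ρ : Measure G) (x : ∀ i, M i → G) (A : Finset (Fin m)) (w : ∀ i, M i) :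
    Measure G :=
  ρ.map fun z => ∑ i ∈ A, x i (w i) + z

variable [MeasurableAdd G] (ρ : Measure G) [IsProbabilityMeasure ρ] (x : ∀ i, M i → G)
  (p : ∀ i, PMF (M i))

instance (A : Finset (Fin m)) (w : ∀ i, M i) : IsProbabilityMeasure (macLaw ρ x A w) :=
  Measure.isProbabilityMeasure_map (by fun_prop)

omit [IsProbabilityMeasure ρ] in
-- This is where additivity of the channel enters: a known message of user `i` acts as a
-- translation, which no divergence can see.
lemma macLaw_insert_update {A : Finset (Fin m)} {i : Fin m} (hi : i ∉ A) (w : ∀ i, M i) (a : M i) :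
    macLaw ρ x (insert i A) (Function.update w i a) =
      (macLaw ρ x A w).map (MeasurableEquiv.addLeft (x i a)) := by
  rw [macLaw, macLaw, Measure.map_map (MeasurableEquiv.measurable _) (by fun_prop)]
  congr 1
  ext z
  rw [Finset.sum_insert hi, Finset.sum_congr rfl fun j hj => by
    rw [Function.update_of_ne (ne_of_mem_of_not_mem hj hi)]]
  simp [add_assoc]

/-- The law of the output of the users in `A ∪ {i}` given that user `i` sends the message `a`. -/
noncomputable def macCondLaw (A : Finset (Fin m)) (i : Fin m) (a : M i) : Measure G :=
  (prodPMF p).mixture fun w => macLaw ρ x (insert i A) (Function.update w i a)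

instance (A : Finset (Fin m)) (i : Fin m) (a : M i) :
    IsProbabilityMeasure (macCondLaw ρ x p A i a) := by
  unfold macCondLaw; infer_instance

omit [IsProbabilityMeasure ρ] in
lemma macCondLaw_eq_map {A : Finset (Fin m)} {i : Fin m} (hi : i ∉ A) (a : M i) :
    macCondLaw ρ x p A i a =
      ((prodPMF p).mixture (macLaw ρ x A)).map (MeasurableEquiv.addLeft (x i a)) := by
  ext s hs
  rw [macCondLaw, PMF.mixture_apply _ _ hs, Measure.map_apply (MeasurableEquiv.measurable _) hs,
    PMF.mixture_apply _ _ (MeasurableEquiv.measurable _ hs)]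
  refine tsum_congr fun w => ?_
  rw [macLaw_insert_update ρ x hi, Measure.map_apply (MeasurableEquiv.measurable _) hs]

/-- The chain rule: the information of the users in `A ∪ {i}` is that of the users in `A` plus
that of user `i` with the other users treated as noise. -/
lemma mutualInfoNats_macLaw_insert [∀ i, Fintype (M i)] {A : Finset (Fin m)} {i : Fin m}
    (hi : i ∉ A) :
    mutualInfoNats (prodPMF p) (macLaw ρ x (insert i A)) =
      mutualInfoNats (prodPMF p) (macLaw ρ x A) +
        ∑ a, p i a * klDiv (macCondLaw ρ x p A i a)
          ((prodPMF p).mixture (macLaw ρ x (insert i A))) := by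
  -- For fixed `a`, the compensation identity is applied over the remaining messages. Translating
  -- back by `x i a` turns its information term into that of `A`, independently of `a`.
  have h : ∀ a, ∑' w, prodPMF p w * klDiv (macLaw ρ x (insert i A) (Function.update w i a))
      ((prodPMF p).mixture (macLaw ρ x (insert i A))) =
      mutualInfoNats (prodPMF p) (macLaw ρ x A) + klDiv (macCondLaw ρ x p A i a)
          ((prodPMF p).mixture (macLaw ρ x (insert i A))) := by
    intro a
    rw [tsum_fintype, sum_mul_klDiv_eq, ← macCondLaw]
    congr 1
    rw [mutualInfoNats, mutualInfoNats, ← macCondLaw, macCondLaw_eq_map ρ x p hi]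
    refine tsum_congr fun w => ?_
    rw [macLaw_insert_update ρ x hi, klDiv_map_measurableEquiv]
  conv_lhs => rw [mutualInfoNats, ← prodPMF_tsum_update p i]
  simp_rw [h, mul_add]
  rw [ENNReal.tsum_add, ENNReal.tsum_mul_right, PMF.tsum_coe, one_mul, tsum_fintype]

lemma mutualInfoNats_macLaw_mono [∀ i, Fintype (M i)] {A : Finset (Fin m)} {i : Fin m}
    (hi : i ∉ A) : mutualInfoNats (prodPMF p) (macLaw ρ x A) ≤
      mutualInfoNats (prodPMF p) (macLaw ρ x (insert i A)) := by
  rw [mutualInfoNats_macLaw_insert ρ x p hi]; exact le_self_add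

omit [MeasurableAdd G] [IsProbabilityMeasure ρ] in
lemma tsum_mul_macCondLaw (A : Finset (Fin m)) (i : Fin m) (E : M i → Set G)
    (hE : ∀ a, MeasurableSet (E a)) :
    ∑' a, p i a * macCondLaw ρ x p A i a (E a) =
      ∑' w, prodPMF p w * macLaw ρ x (insert i A) w (E (w i)) := by
  rw [← prodPMF_tsum_update p i]
  refine tsum_congr fun a => ?_
  rw [macCondLaw, PMF.mixture_apply _ _ (hE a)]
  simp

/-- Fano's inequality for user `i`: the sets `E a` are those outputs that are decoded as a value
compatible with the message `a`. -/
lemma fano_macLaw [∀ i, Fintype (M i)] {A : Finset (Fin m)} {i : Fin m}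
    (hi : i ∉ A) (E : M i → Set G) (hE : ∀ a, MeasurableSet (E a)) {c L : ℝ} (hL : 0 < L)
    (hc : c ≤ ∑ w, (prodPMF p w).toReal * (macLaw ρ x (insert i A) w).real (E (w i)))
    (hcount : ∀ y, ∑ a, (p i a).toReal * (E a).indicator 1 y ≤ L⁻¹) (hL1 : 1 ≤ L) :
    (mutualInfoNats (prodPMF p) (macLaw ρ x A)).toReal + (c * Real.log L - Real.log 2) ≤
      (mutualInfoNats (prodPMF p) (macLaw ρ x (insert i A))).toReal := by
  set Q := (prodPMF p).mixture (macLaw ρ x (insert i A)) with hQ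
  have hI := mutualInfoNats_macLaw_insert ρ x p hi
  have htop := mutualInfoNats_ne_top (prodPMF p) (macLaw ρ x (insert i A))
  have hsum : ∑ a, p i a * klDiv (macCondLaw ρ x p A i a) Q ≠ ∞ :=
    ne_top_of_le_ne_top htop (hI ▸ le_add_self)
  rw [hI, ENNReal.toReal_add (mutualInfoNats_ne_top _ _) hsum]
  refine add_le_add_right ?_ _
  have hterm : ∀ a, p i a * klDiv (macCondLaw ρ x p A i a) Q ≠ ∞ := fun a =>
    ne_top_of_le_ne_top hsum
      (Finset.single_le_sum (f := fun a => p i a * klDiv (macCondLaw ρ x p A i a) Q)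
        (fun _ _ => zero_le) (Finset.mem_univ a))
  rw [ENNReal.toReal_sum fun a _ => hterm a]
  have h1 : ∀ a, (p i a).toReal * ((macCondLaw ρ x p A i a).real (E a) * Real.log L - Real.log 2 -
      (L * Q.real (E a) - 1) / 2) ≤ (p i a * klDiv (macCondLaw ρ x p A i a) Q).toReal := by
    intro a
    rw [ENNReal.toReal_mul]
    by_cases ha : p i a = 0
    · simp [ha]
    refine mul_le_mul_of_nonneg_left (mul_log_sub_le_toReal_klDiv ?_ (hE a) hL)
      ENNReal.toReal_nonneg
    intro h
    exact hterm a (by rw [h, ENNReal.mul_top ha])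
  refine le_trans ?_ (Finset.sum_le_sum fun a _ => h1 a)
  have h2 : ∑ a, (p i a).toReal * (macCondLaw ρ x p A i a).real (E a) =
      ∑ w, (prodPMF p w).toReal * (macLaw ρ x (insert i A) w).real (E (w i)) := by
    have := congrArg ENNReal.toReal (tsum_mul_macCondLaw ρ x p A i E hE)
    rw [tsum_fintype, tsum_fintype, ENNReal.toReal_sum, ENNReal.toReal_sum] at this
    · simpa [ENNReal.toReal_mul, measureReal_def] using this
    · exact fun w _ => ENNReal.mul_ne_top (PMF.apply_ne_top _ _) (measure_ne_top _ _)
    · exact fun w _ => ENNReal.mul_ne_top (PMF.apply_ne_top _ _) (measure_ne_top _ _)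
  -- Under the reference law `Q` the output is independent of the message, so success is mere
  -- guessing; `hcount` is integrated over the output.
  have h3 : ∑ a, (p i a).toReal * Q.real (E a) ≤ L⁻¹ := by
    have : ∑ a, (p i a).toReal * Q.real (E a) =
        ∫ y, ∑ a, (p i a).toReal * (E a).indicator 1 y ∂Q := by
      rw [integral_finsetSum]
      · refine Finset.sum_congr rfl fun a _ => ?_
        rw [integral_const_mul, integral_indicator_one (hE a)]
      · exact fun a _ => ((integrable_const 1).indicator (hE a)).const_mul _
    rw [this]
    calc _ ≤ ∫ _, L⁻¹ ∂Q := by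
          refine integral_mono ?_ (integrable_const _) hcount
          exact integrable_finsetSum _ fun a _ =>
            ((integrable_const 1).indicator (hE a)).const_mul _
      _ = L⁻¹ := by simp
  have h4 : L * ∑ a, (p i a).toReal * Q.real (E a) ≤ 1 := by
    calc _ ≤ L * L⁻¹ := by gcongr
      _ = 1 := mul_inv_cancel₀ hL.ne'
  have h5 : ∑ a, (p i a).toReal * ((macCondLaw ρ x p A i a).real (E a) * Real.log L - Real.log 2 -
      (L * Q.real (E a) - 1) / 2) =
      (∑ a, (p i a).toReal * (macCondLaw ρ x p A i a).real (E a)) * Real.log L - Real.log 2 -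
        (L * (∑ a, (p i a).toReal * Q.real (E a)) - 1) / 2 := by
    have hs := (p i).sum_toReal
    have : ∀ a, (p i a).toReal * ((macCondLaw ρ x p A i a).real (E a) * Real.log L - Real.log 2 -
      (L * Q.real (E a) - 1) / 2) = (p i a).toReal * (macCondLaw ρ x p A i a).real (E a) *
        Real.log L - L / 2 * ((p i a).toReal * Q.real (E a)) -
        (p i a).toReal * (Real.log 2 - 1 / 2) := fun a => by ring
    simp_rw [this]
    rw [Finset.sum_sub_distrib, Finset.sum_sub_distrib, ← Finset.sum_mul, ← Finset.sum_mul,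
      ← Finset.mul_sum, hs]
    ring
  rw [h5, h2]
  have := mul_le_mul_of_nonneg_right hc (Real.log_nonneg hL1)
  linarith

end AdditiveMAC

/-! ### Reduction from blocks to single letters -/

section Memoryless

variable {m n : ℕ} {M : Fin m → Type*} [∀ i, Fintype (M i)] {F : Type*} [AddCommGroup F]
  [MeasurableSpace F] [MeasurableAdd F] (ν : Measure F) [IsProbabilityMeasure ν]
  (x : ∀ i, M i → Fin n → F) (p : ∀ i, PMF (M i))

omit [∀ i, Fintype (M i)] in
lemma macLaw_pi (A : Finset (Fin m)) (w : ∀ i, M i) :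
    macLaw (Measure.pi fun _ : Fin n => ν) x A w =
      Measure.pi fun t => macLaw ν (fun i a => x i a t) A w := by
  unfold macLaw
  rw [← Measure.pi_map_pi (fun t => by fun_prop)]
  congr 1
  ext z t
  simp

/-- Single-letterization. -/
lemma mutualInfoNats_macLaw_pi_le (A : Finset (Fin m)) :
    mutualInfoNats (prodPMF p) (macLaw (Measure.pi fun _ : Fin n => ν) x A) ≤
      ∑ t, mutualInfoNats (prodPMF p) (macLaw ν (fun i a => x i a t) A) := by
  -- The reference is the product of the single-letter output laws. For a fixed message both laws
  -- are products, so the divergence splits over time.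
  refine (mutualInfoNats_le_sum_klDiv _ _ (Measure.pi fun t =>
    (prodPMF p).mixture (macLaw ν (fun i a => x i a t) A))).trans_eq ?_
  simp_rw [macLaw_pi, klDiv_pi, Finset.mul_sum]
  rw [Finset.sum_comm]
  simp [mutualInfoNats]

end Memoryless

/-! ### Time sharing, orderings of the users and counting of messages -/

section Combinatorics

/-- Carathéodory's theorem: the time average of the vectors `I t` lies in their convex hull in
`ℝ^κ`, hence is a convex combination of affinely independent ones, of which there are at most `|κ| +
1`. -/
lemma exists_timeSharing {κ : Type} [Fintype κ] {n : ℕ} (hn : 0 < n) (I : Fin n → κ → ℝ≥0∞)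
    (hI : ∀ t A, I t A ≠ ∞) :
    ∃ N ≤ Fintype.card κ + 1, ∃ (q : PMF (Fin N)) (s : Fin N → Fin n), ∀ A,
      ∑ k, q k * I (s k) A = ENNReal.ofReal ((∑ t, (I t A).toReal) / n) := by
  set v : Fin n → κ → ℝ := fun t A => (I t A).toReal with hv
  have hn' : (n : ℝ) ≠ 0 := by positivity
  have hmem : ∑ t, (n : ℝ)⁻¹ • v t ∈ convexHull ℝ (Set.range v) := by
    refine (convex_convexHull ℝ _).sum_mem (fun _ _ => by positivity) ?_
      fun t _ => subset_convexHull _ _ ⟨t, rfl⟩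
    simp [hn']
  obtain ⟨ι, _, z, w, hz, hind, hw, hw1, hwz⟩ := eq_pos_convex_span_of_mem_convexHull hmem
  choose s hs using fun i => hz ⟨i, rfl⟩
  set e := (Fintype.equivFin ι).symm
  refine ⟨Fintype.card ι, ?_, PMF.ofFintype (fun k => ENNReal.ofReal (w (e k))) ?_,
    fun k => s (e k), fun A => ?_⟩
  · refine hind.card_le_finrank_succ.trans (Nat.succ_le_succ ?_)
    simpa using Submodule.finrank_le (vectorSpan ℝ (Set.range z))
  · rw [← ENNReal.ofReal_sum_of_nonneg fun k _ => (hw _).le, e.sum_comp w, hw1,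
      ENNReal.ofReal_one]
  · have h1 : ∀ k, ENNReal.ofReal (w (e k)) * I (s (e k)) A =
        ENNReal.ofReal (w (e k) * z (e k) A) := by
      intro k
      rw [ENNReal.ofReal_mul (hw _).le, ← hs, ENNReal.ofReal_toReal (hI _ _)]
    simp only [PMF.ofFintype_apply, h1]
    rw [← ENNReal.ofReal_sum_of_nonneg, e.sum_comp fun i => w i * z i A]
    · have h2 := congrFun hwz A
      simp only [Finset.sum_apply, Pi.smul_apply, smul_eq_mul] at h2
      rw [h2, ← Finset.mul_sum, div_eq_inv_mul]
    · intro k _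
      rw [← hs]
      exact mul_nonneg (hw _).le ENNReal.toReal_nonneg

lemma card_receiver_add_one_le (m : ℕ) : Fintype.card (Receiver m) + 1 ≤ 2 ^ m := by
  have h := Fintype.card_subtype_lt (p := fun A : Finset (Fin m) => A.Nonempty) (x := ∅) (by simp)
  rw [Fintype.card_finset, Fintype.card_fin] at h
  exact h

lemma two_pow_le_factorial_mul {m : ℕ} (hm : 2 ≤ m) : 2 ^ m ≤ m ! * m := by
  induction m, hm using Nat.le_induction with
  | base => decide
  | succ m hm ih =>
    rw [pow_succ, Nat.factorial_succ]
    calc 2 ^ m * 2 ≤ (m ! * m) * (m + 1) := Nat.mul_le_mul ih (by omega)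
      _ ≤ (m ! * (m + 1)) * (m + 1) := by gcongr; omega
      _ = (m + 1) * m ! * (m + 1) := by ring

lemma firstUsers_zero {m : ℕ} (σ : Equiv.Perm (Fin (m + 1))) :
    (firstUsers σ 0).1 = insert (σ 0) ∅ := by
  ext i
  simp [firstUsers, Equiv.symm_apply_eq]

lemma firstUsers_succ {m : ℕ} (σ : Equiv.Perm (Fin (m + 1))) (k : Fin m) :
    (firstUsers σ k.succ).1 = insert (σ k.succ) (firstUsers σ k.castSucc).1 := by
  have : Finset.Iic k.succ = insert k.succ (Finset.Iic k.castSucc) := by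
    ext j
    simp [Fin.le_def, Fin.ext_iff]
    omega
  simp [firstUsers, this, Finset.map_insert]

/-- Telescoping along the chain of sets of first users; `f` will be the block information and `δ`
the Fano bound. -/
lemma sum_Iic_le_of_insert {m : ℕ} (f : Finset (Fin m) → ℝ) (δ : Fin m → Finset (Fin m) → ℝ)
    (h0 : 0 ≤ f ∅) (h : ∀ i A, i ∉ A → f A + δ i (insert i A) ≤ f (insert i A))
    (σ : Equiv.Perm (Fin m)) (K : Fin m) :
    ∑ k ∈ Finset.Iic K, δ (σ k) (firstUsers σ k).1 ≤ f (firstUsers σ K).1 := by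
  cases m with
  | zero => exact K.elim0
  | succ m =>
    induction K using Fin.induction with
    | zero =>
      have : Finset.Iic (0 : Fin (m + 1)) = {0} := by ext j; simp
      rw [this, Finset.sum_singleton, firstUsers_zero]
      have := h (σ 0) ∅ (by simp)
      linarith
    | succ k ih =>
      have hI : Finset.Iic k.succ = insert k.succ (Finset.Iic k.castSucc) := by
        ext j
        simp [Fin.le_def, Fin.ext_iff]
        omega
      rw [hI, Finset.sum_insert (by simp [Fin.le_def]), firstUsers_succ]
      have := h (σ k.succ) (firstUsers σ k.castSucc).1 (by simp [firstUsers, Fin.le_def])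
      linarith

lemma card_filter_forall_mem_eq_mul {ι : Type*} [Fintype ι] [DecidableEq ι] {c : ι → ℕ}
    (S : Finset ι) (b : ∀ j, Fin (c j))
    [DecidablePred fun a : ∀ j, Fin (c j) => ∀ j ∈ S, b j = a j] :
    (Finset.univ.filter fun a : ∀ j, Fin (c j) => ∀ j ∈ S, b j = a j).card * ∏ j ∈ S, c j =
      ∏ j, c j := by
  have h : (Finset.univ.filter fun a : ∀ j, Fin (c j) => ∀ j ∈ S, b j = a j) =
      Fintype.piFinset fun j => if j ∈ S then {b j} else Finset.univ := by
    ext a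
    simp only [Finset.mem_filter, Finset.mem_univ, true_and, Fintype.mem_piFinset]
    refine forall_congr' fun j => ?_
    split_ifs with hj <;> simp [hj, eq_comm]
  rw [h, Fintype.card_piFinset, ← Finset.prod_compl_mul_prod S c,
    ← Finset.prod_compl_mul_prod S fun j => (if j ∈ S then {b j} else Finset.univ).card]
  have h1 : ∏ j ∈ S, (if j ∈ S then ({b j} : Finset (Fin (c j))) else Finset.univ).card = 1 :=
    Finset.prod_eq_one fun j hj => by simp [hj]
  have h2 : ∏ j ∈ Sᶜ, (if j ∈ S then ({b j} : Finset (Fin (c j))) else Finset.univ).card =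
      ∏ j ∈ Sᶜ, c j :=
    Finset.prod_congr rfl fun j hj => by simp [Finset.mem_compl.1 hj]
  rw [h1, h2, mul_one]

lemma msgCard_pos (n : ℕ) (R : ℝ) : 0 < msgCard n R := Nat.ceil_pos.2 (by positivity)

instance (n : ℕ) (R : ℝ) : NeZero (msgCard n R) := ⟨(msgCard_pos n R).ne'⟩

lemma mul_log_two_le_log_msgCard (n : ℕ) (R : ℝ) :
    n * R * Real.log 2 ≤ Real.log (msgCard n R) := by
  rw [← Real.log_rpow two_pos]
  exact Real.log_le_log (by positivity) (Nat.le_ceil _)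

end Combinatorics

/-! ### The random access channel as an additive multiple-access channel -/

namespace AdditiveRAC

variable {m : ℕ} {X : Fin m → Type*} {F Z : Type*}
  [Field F] [MeasurableSpace F] [MeasurableAdd F] [MeasurableSpace Z] (ch : AdditiveRAC X F Z)

/-- The law of the noise at receiver `A`, as an element of `F`. -/
noncomputable def noiseF (A : Receiver m) : Measure F := (ch.noise A).map ch.noiseEmb

instance (A : Receiver m) : IsProbabilityMeasure (ch.noise A) := ch.isProbabilityMeasure_noise A

instance (A : Receiver m) : IsProbabilityMeasure (ch.noiseF A) :=
  Measure.isProbabilityMeasure_map ch.measurable_noiseEmb.aemeasurable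

lemma outputLaw_eq_macLaw (A : Receiver m) (x : ∀ i, X i) :
    ch.outputLaw A (fun i => x i) = macLaw (ch.noiseF A) (fun i => ch.inputEmb i) A.1 x := by
  rw [outputLaw, macLaw, noiseF, Measure.map_map (by fun_prop) ch.measurable_noiseEmb]
  congr 1
  ext z
  simp only [output, Function.comp]
  rw [Finset.sum_coe_sort A.1 fun i => ch.inputEmb i (x i)]

lemma inputOutputInfo_eq (p : PMF (∀ i, X i)) (A : Receiver m) :
    ch.inputOutputInfo p A = mutualInfoNats p (macLaw (ch.noiseF A) (fun i => ch.inputEmb i) A.1) /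
      ENNReal.ofReal (Real.log 2) := by
  rw [inputOutputInfo, mutualInfo_map, mutualInfo_eq_div]
  congr 2
  ext1 x
  exact ch.outputLaw_eq_macLaw A x

/-- Because of this, the unconditional constraint of the outer region never has to be checked
separately for such input laws. -/
lemma condInputOutputInfo_le {N : ℕ} {κ : Fin m → Type*} [∀ i, Fintype (κ i)] (pQ : PMF (Fin N))
    (p : Fin N → ∀ i, PMF (κ i)) (g : Fin N → ∀ i, κ i → X i) (A : Receiver m) :
    ch.condInputOutputInfo pQ (fun q i => (p q i).map (g q i)) A ≤
      ch.inputOutputInfo (pQ.bind fun q => prodPMF fun i => (p q i).map (g q i)) A := by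
  simp only [condInputOutputInfo, inputOutputInfo_eq, prodPMF_map, ← mul_div_assoc]
  have h := tsum_mul_mutualInfoNats_le pQ (fun q => prodPMF (p q)) (fun q w i => g q i (w i))
    (macLaw (ch.noiseF A) (fun i => ch.inputEmb i) A.1)
  rw [tsum_fintype] at h
  simp only [div_eq_mul_inv, ← Finset.sum_mul]
  exact mul_le_mul_left h _

/-! ### Codes: error probability and decoding sets -/

section Code

variable {𝓦 : MessageStructure m} {R : 𝓦.Rates} {n : ℕ} (c : RACCode X F 𝓦 R n)

/-- The codewords of user `i`, as elements of `F^n`. -/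
def codeword (i : Fin m) (a : ∀ j, Fin (msgCard n (R i j))) (t : Fin n) : F :=
  ch.inputEmb i (c.enc i a t)

/-- The uniform distribution of the messages of user `i`. -/
noncomputable def _root_.msgPMF (R : 𝓦.Rates) (n : ℕ) (i : Fin m) :
    PMF (∀ j, Fin (msgCard n (R i j))) :=
  PMF.uniformOfFintype _

lemma map_received (A : Receiver m) (w : ∀ i j, Fin (msgCard n (R i j))) :
    (ch.noiseLaw n).map (ch.received c A w) =
      macLaw (Measure.pi fun _ : Fin n => ch.noiseF A) (ch.codeword c) A.1 w := by
  rw [macLaw_pi, noiseLaw]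
  have h : ch.received c A w = fun z t => ((fun y => ∑ i ∈ A.1, ch.codeword c i (w i) t + y) ∘
      ch.noiseEmb ∘ Function.eval A) (z t) := by
    ext z t
    simp only [received, output, codeword, Function.comp, Function.eval]
    rw [Finset.sum_coe_sort A.1 fun i => ch.inputEmb i (c.enc i (w i) t)]
  have hm := ch.measurable_noiseEmb
  have hm' : Measurable (ch.noiseEmb ∘ Function.eval (β := fun _ : Receiver m => Z) A) :=
    hm.comp (measurable_pi_apply A)
  rw [h, Measure.pi_map_pi fun t => ((measurable_const_add _).comp hm').aemeasurable]
  congr 1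
  ext1 t
  have he : Measurable (Function.eval (β := fun _ : Receiver m => Z) A) := measurable_pi_apply A
  rw [macLaw, noiseF, Measure.map_map (by fun_prop) hm, ← (measurePreserving_eval ch.noise A).map_eq,
    Measure.map_map (by fun_prop) he]
  rfl

lemma measurable_received (A : Receiver m) (w : ∀ i j, Fin (msgCard n (R i j))) :
    Measurable (ch.received c A w) := by
  have hm := ch.measurable_noiseEmb
  unfold received output
  fun_prop

/-- The outputs for which receiver `A` decodes the messages of user `i` to those in `a`. -/
def _root_.RACCode.decodeSet (c : RACCode X F 𝓦 R n) (A : Receiver m) {i : Fin m} (hi : i ∈ A.1)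
    (a : ∀ j, Fin (msgCard n (R i j))) : Set (Fin n → F) :=
  {y | ∀ j (hj : j ∈ 𝓦.decoded i A.1), c.dec A y ⟨⟨i, j⟩, hi, hj⟩ = a j}

omit [Field F] [MeasurableAdd F] in
lemma _root_.RACCode.measurableSet_decodeSet (c : RACCode X F 𝓦 R n) (A : Receiver m) {i : Fin m}
    (hi : i ∈ A.1) (a : ∀ j, Fin (msgCard n (R i j))) : MeasurableSet (c.decodeSet A hi a) :=
  c.measurable_dec A (Set.toFinite {d : ∀ p : 𝓦.Target A.1, Fin (msgCard n (R p.1.1 p.1.2)) |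
    ∀ j (hj : j ∈ 𝓦.decoded i A.1), d ⟨⟨i, j⟩, hi, hj⟩ = a j}).measurableSet

lemma prodPMF_msgPMF_toReal (w : ∀ i j, Fin (msgCard n (R i j))) :
    (prodPMF (msgPMF R n) w).toReal =
      (Fintype.card (∀ i j, Fin (msgCard n (R i j))) : ℝ)⁻¹ := by
  rw [prodPMF_apply]
  simp only [msgPMF, PMF.uniformOfFintype_apply]
  rw [ENNReal.toReal_prod, Fintype.card_pi]
  simp

lemma one_sub_errorProb_le (A : Receiver m) {i : Fin m} (hi : i ∈ A.1) :
    1 - ch.errorProb c A ≤ ∑ w, (prodPMF (msgPMF R n) w).toReal *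
      (macLaw (Measure.pi fun _ : Fin n => ch.noiseF A) (ch.codeword c) A.1 w).real
        (c.decodeSet A hi (w i)) := by
  have h1 : ∀ w, 1 - (ch.noiseLaw n).real {z | ∃ p : 𝓦.Target A.1,
        c.dec A (ch.received c A w z) p ≠ w p.1.1 p.1.2} ≤
      (macLaw (Measure.pi fun _ : Fin n => ch.noiseF A) (ch.codeword c) A.1 w).real
        (c.decodeSet A hi (w i)) := by
    intro w
    have : IsProbabilityMeasure (ch.noiseLaw n) := by unfold noiseLaw; infer_instance
    rw [← map_received, map_measureReal_apply (ch.measurable_received c A w)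
      (c.measurableSet_decodeSet A hi _)]
    have hd : MeasurableSet (ch.received c A w ⁻¹' c.decodeSet A hi (w i)) :=
      ch.measurable_received c A w (c.measurableSet_decodeSet A hi _)
    rw [sub_le_comm, ← probReal_compl_eq_one_sub hd]
    refine measureReal_mono fun z hz => ?_
    simp only [RACCode.decodeSet, Set.mem_compl_iff, Set.mem_preimage, Set.mem_ofPred_eq,
      not_forall] at hz
    obtain ⟨j, hj, hne⟩ := hz
    exact ⟨_, hne⟩
  simp only [prodPMF_msgPMF_toReal, ← Finset.mul_sum]
  have hcard : (0 : ℝ) < Fintype.card (∀ i j, Fin (msgCard n (R i j))) := by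
    exact_mod_cast Fintype.card_pos
  rw [errorProb, ← div_eq_inv_mul, le_div_iff₀ hcard, sub_mul, div_mul_cancel₀ _ hcard.ne', one_mul]
  refine le_trans (le_of_eq ?_) (Finset.sum_le_sum fun w _ => h1 w)
  rw [Finset.sum_sub_distrib]
  simp

/-- The number of values that the messages of user `i` for receiver `A` can take. -/
noncomputable def _root_.numTargets (R : 𝓦.Rates) (n : ℕ) (i : Fin m) (A : Finset (Fin m)) : ℕ :=
  ∏ j ∈ 𝓦.decoded i A, msgCard n (R i j)

omit [Field F] [MeasurableAdd F] in
-- An output fixes the decoded coordinates, so a uniform message is compatible with it with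
-- probability one over the number of their values. This is the counting hypothesis of
-- `fano_macLaw`.
lemma sum_indicator_decodeSet_le (A : Receiver m) {i : Fin m} (hi : i ∈ A.1) (y : Fin n → F) :
    ∑ a, (msgPMF R n i a).toReal * (c.decodeSet A hi a).indicator (1 : (Fin n → F) → ℝ) y ≤
      (numTargets R n i A.1 : ℝ)⁻¹ := by
  let b : ∀ j, Fin (msgCard n (R i j)) := fun j =>
    if hj : j ∈ 𝓦.decoded i A.1 then c.dec A y ⟨⟨i, j⟩, hi, hj⟩ else 0
  have h : ∀ a, (c.decodeSet A hi a).indicator (1 : (Fin n → F) → ℝ) y =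
      if ∀ j ∈ 𝓦.decoded i A.1, b j = a j then 1 else 0 := by
    intro a
    have : y ∈ c.decodeSet A hi a ↔ ∀ j ∈ 𝓦.decoded i A.1, b j = a j :=
      forall_congr' fun j => forall_congr' fun hj => by simp [b, hj]
    split_ifs with h
    · rw [Set.indicator_of_mem (this.2 h), Pi.one_apply]
    · rw [Set.indicator_of_notMem (this.not.2 h)]
  simp only [h, msgPMF, PMF.uniformOfFintype_apply]
  rw [← Finset.mul_sum, Finset.sum_boole]
  have h2 := card_filter_forall_mem_eq_mul (𝓦.decoded i A.1) b
  have hpos : 0 < ∏ j, msgCard n (R i j) := Finset.prod_pos fun j _ => msgCard_pos _ _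
  have hL : 0 < ∏ j ∈ 𝓦.decoded i A.1, msgCard n (R i j) :=
    Finset.prod_pos fun j _ => msgCard_pos _ _
  rw [Fintype.card_pi, numTargets]
  simp only [Fintype.card_fin, ENNReal.toReal_inv, ENNReal.toReal_natCast]
  have hpos' : (0 : ℝ) < (∏ j, msgCard n (R i j) : ℕ) := by exact_mod_cast hpos
  have hL' : (0 : ℝ) < (∏ j ∈ 𝓦.decoded i A.1, msgCard n (R i j) : ℕ) := by exact_mod_cast hL
  rw [← div_eq_inv_mul, div_le_iff₀ hpos', ← div_eq_inv_mul, le_div_iff₀ hL']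
  exact_mod_cast h2.le

lemma le_log_numTargets (i : Fin m) (A : Finset (Fin m)) :
    n * (∑ j ∈ 𝓦.decoded i A, R i j) * Real.log 2 ≤ Real.log (numTargets R n i A) := by
  rw [numTargets, Nat.cast_prod, Real.log_prod fun j _ => by
    exact_mod_cast (msgCard_pos n (R i j)).ne', Finset.mul_sum, Finset.sum_mul]
  exact Finset.sum_le_sum fun j _ => mul_log_two_le_log_msgCard _ _

end Code

end AdditiveRAC

/-! ### The converse for a single code and the limit of large block length -/

namespace AdditiveRAC

variable {m : ℕ} {X : Fin m → Type*} {F Z : Type*}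
  [Field F] [MeasurableSpace F] [MeasurableAdd F] [MeasurableSpace Z] (ch : AdditiveRAC X F Z)
  {𝓦 : MessageStructure m} {R : 𝓦.Rates} {n : ℕ} (c : RACCode X F 𝓦 R n)

/-- The information, in nats, between the messages of the users in `A` and their noisy sum
over a whole block. -/
noncomputable def blockInfo (ν : Measure F) (A : Finset (Fin m)) : ℝ :=
  (mutualInfoNats (prodPMF (msgPMF R n))
    (macLaw (Measure.pi fun _ : Fin n => ν) (ch.codeword c) A)).toReal

/-- Fano's inequality gives the increment without truncation; monotonicity of the information in the
set of users covers the cases in which a maximum equals `0`. The truncation keeps the reduced rates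
non-negative. -/
lemma blockInfo_insert (ν : Measure F) [IsProbabilityMeasure ν]
    (hν : ∀ A, ch.noiseF A = ν) {A : Finset (Fin m)} {i : Fin m} (hi : i ∉ A) {ε : ℝ}
    (hε : ∀ A, ch.errorProb c A ≤ ε) :
    ch.blockInfo c ν A + max 0 (max 0 (1 - ε) *
      (n * (∑ j ∈ 𝓦.decoded i (insert i A), R i j) * Real.log 2) - Real.log 2) ≤
      ch.blockInfo c ν (insert i A) := by
  have hlog := Real.log_pos one_lt_two
  have hmono : ch.blockInfo c ν A ≤ ch.blockInfo c ν (insert i A) :=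
    ENNReal.toReal_mono (mutualInfoNats_ne_top _ _) (mutualInfoNats_macLaw_mono _ _ _ hi)
  rcases le_total (1 - ε) 0 with h | h
  · rw [max_eq_left h, zero_mul, zero_sub, max_eq_left (by linarith), add_zero]
    exact hmono
  rw [max_eq_right h, add_comm, ← le_sub_iff_add_le]
  refine max_le (by linarith) ?_
  rw [le_sub_iff_add_le, add_comm]
  let B : Receiver m := ⟨insert i A, Finset.insert_nonempty i A⟩
  have hiB : i ∈ B.1 := Finset.mem_insert_self i A
  have hL : 1 ≤ numTargets R n i B.1 :=
    Finset.prod_pos fun j _ => msgCard_pos _ _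
  have hF := fano_macLaw (Measure.pi fun _ : Fin n => ν) (ch.codeword c) (msgPMF R n) hi
    (c.decodeSet B hiB) (c.measurableSet_decodeSet B hiB) (c := 1 - ε) (L := numTargets R n i B.1)
    (by exact_mod_cast hL)
    ((sub_le_sub_left (hε B) 1).trans (by simpa only [hν] using ch.one_sub_errorProb_le c B hiB))
    (sum_indicator_decodeSet_le c B hiB) (by exact_mod_cast hL)
  refine le_trans ?_ hF
  have h1 : n * (∑ j ∈ 𝓦.decoded i (insert i A), R i j) * Real.log 2 ≤
    Real.log (numTargets R n i B.1) := le_log_numTargets i _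
  have := mul_le_mul_of_nonneg_left h1 h
  rw [blockInfo]
  linarith

lemma blockInfo_le (ν : Measure F) [IsProbabilityMeasure ν]
    (hν : ∀ A, ch.noiseF A = ν) (A : Receiver m) :
    ch.blockInfo c ν A.1 ≤ Real.log 2 * ∑ t, (ch.inputOutputInfo
      (prodPMF fun i => (msgPMF R n i).map fun a => c.enc i a t) A).toReal := by
  have h := mutualInfoNats_macLaw_pi_le ν (ch.codeword c) (msgPMF R n) A.1
  have h2 := ENNReal.toReal_mono
    (ENNReal.sum_ne_top.2 fun t _ => mutualInfoNats_ne_top _ _) h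
  rw [ENNReal.toReal_sum fun t _ => mutualInfoNats_ne_top _ _] at h2
  refine h2.trans (le_of_eq ?_)
  rw [Finset.mul_sum]
  refine Finset.sum_congr rfl fun t _ => ?_
  have hlog := Real.log_pos one_lt_two
  rw [inputOutputInfo_eq, prodPMF_map, mutualInfoNats_map, ENNReal.toReal_div,
    ENNReal.toReal_ofReal hlog.le, mul_div_cancel₀ _ hlog.ne', hν]
  rfl

lemma inputOutputInfo_ne_top {κ : Fin m → Type*} [∀ i, Fintype (κ i)]
    (p : ∀ i, PMF (κ i)) (g : ∀ i, κ i → X i) (A : Receiver m) :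
    ch.inputOutputInfo (prodPMF fun i => (p i).map (g i)) A ≠ ∞ := by
  rw [inputOutputInfo_eq, prodPMF_map, mutualInfoNats_map]
  refine ENNReal.div_ne_top ?_ (by simpa using Real.log_pos one_lt_two)
  have : ∀ w, IsProbabilityMeasure ((macLaw (ch.noiseF A) (fun i => ch.inputEmb i) A.1 ∘
      fun (w : ∀ i, κ i) i => g i (w i)) w) := fun w => by
    simp only [Function.comp]; infer_instance
  exact mutualInfoNats_ne_top _ _

/-- A code with small error probabilities puts slightly reduced rates into the outer region. -/
lemma reduced_mem_outerRegion (hm : 2 ≤ m) (hn : 0 < n) (hR : ∀ i j, 0 ≤ R i j) (ν : Measure F)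
    [IsProbabilityMeasure ν] (hν : ∀ A, ch.noiseF A = ν) {r : RateTuple m}
    (hr : ∀ p, r p = ∑ j ∈ 𝓦.decoded p.1.1 p.1.2, R p.1.1 j) {ε : ℝ}
    (hε : ∀ A, ch.errorProb c A ≤ ε) :
    (fun p => max 0 (max 0 (1 - ε) * r p - 1 / n)) ∈ ch.outerRegion := by
  have hlog := Real.log_pos one_lt_two
  have hn' : (0 : ℝ) < n := by exact_mod_cast hn
  -- All rates are reduced by the same monotone function, which preserves the order constraints.
  refine ⟨fun p => le_max_left _ _, fun i A B hA hAB => ?_, ?_⟩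
  · have : r ⟨(i, B), hAB hA⟩ ≤ r ⟨(i, A), hA⟩ := by
      rw [hr, hr]
      exact Finset.sum_le_sum_of_subset_of_nonneg (𝓦.decoded_anti i A B hA hAB)
        fun j _ _ => hR i j
    dsimp only
    gcongr
  obtain ⟨N, hN, q, s, hq⟩ := exists_timeSharing hn (fun t A => ch.inputOutputInfo
      (prodPMF fun i => (msgPMF R n i).map fun a => c.enc i a t) A)
      fun t A => ch.inputOutputInfo_ne_top (msgPMF R n) (fun i a => c.enc i a t) A
  refine ⟨N, hN.trans ((card_receiver_add_one_le m).trans (two_pow_le_factorial_mul hm)), q,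
    fun k i => (msgPMF R n i).map fun a => c.enc i a (s k), fun σ K => ?_⟩
  have hcond : ENNReal.ofReal (∑ k ∈ Finset.Iic K,
      max 0 (max 0 (1 - ε) * r ⟨(σ k, (firstUsers σ k).1), mem_firstUsers σ k⟩ - 1 / n)) ≤
      ch.condInputOutputInfo q (fun k i => (msgPMF R n i).map fun a => c.enc i a (s k))
        (firstUsers σ K) := by
    rw [condInputOutputInfo, hq]
    refine ENNReal.ofReal_le_ofReal ?_
    -- The loss `log 2` in each Fano step is one bit per block, which becomes `1 / n` after division
    -- by `n log 2`.
    have h1 := sum_Iic_le_of_insert (ch.blockInfo c ν) (fun i B => max 0 (max 0 (1 - ε) *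
      (n * (∑ j ∈ 𝓦.decoded i B, R i j) * Real.log 2) - Real.log 2))
      ENNReal.toReal_nonneg (fun i A hi => ch.blockInfo_insert c ν hν hi hε) σ K
    have h2 := h1.trans (ch.blockInfo_le c ν hν (firstUsers σ K))
    rw [le_div_iff₀ hn']
    refine le_of_mul_le_mul_left (h2.trans' (le_of_eq ?_)) hlog
    rw [Finset.sum_mul, Finset.mul_sum]
    refine Finset.sum_congr rfl fun k _ => ?_
    rw [hr, max_mul_of_nonneg _ _ hn'.le, mul_max_of_nonneg _ _ hlog.le]
    congr 1
    · ring
    · field_simp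
  exact ⟨hcond, hcond.trans (ch.condInputOutputInfo_le q (fun _ => msgPMF R n)
    (fun k i a => c.enc i a (s k)) _)⟩

omit [MeasurableAdd F] in
lemma errorProb_nonneg (A : Receiver m) : 0 ≤ ch.errorProb c A :=
  div_nonneg (Finset.sum_nonneg fun _ _ => measureReal_nonneg) (Nat.cast_nonneg _)

theorem achievable_subset_closure (hm : 2 ≤ m)
    (hnoise : ∀ A B : Receiver m, ch.noise A = ch.noise B) (𝓦 : MessageStructure m) :
    ch.achievable 𝓦 ⊆ closure ch.outerRegion := by
  rintro r ⟨R, hR, hr, c, hc⟩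
  let A₀ : Receiver m := ⟨{⟨0, by omega⟩}, Finset.singleton_nonempty _⟩
  have hν : ∀ A, ch.noiseF A = ch.noiseF A₀ := fun A => by rw [noiseF, noiseF, hnoise A A₀]
  -- The sum of the error probabilities bounds each of them and still tends to `0`; the truncation
  -- disappears in the limit since `r p ≥ 0`.
  have hlim : Tendsto (fun n : ℕ => fun p => max 0 (max 0 (1 - ∑ A, ch.errorProb (c n) A) * r p -
      1 / (n : ℝ))) atTop (𝓝 r) := by
    refine tendsto_pi_nhds.2 fun p => ?_
    have h1 : Tendsto (fun n => ∑ A, ch.errorProb (c n) A) atTop (𝓝 0) := by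
      simpa using tendsto_finsetSum Finset.univ fun A _ => hc A
    have h2 := (tendsto_const_nhds (x := (0 : ℝ))).max ((((tendsto_const_nhds (x := (0 : ℝ))).max
      ((tendsto_const_nhds (x := (1 : ℝ))).sub h1)).mul_const (r p)).sub
        tendsto_one_div_atTop_nhds_zero_nat)
    have h3 : 0 ≤ r p := by rw [hr]; exact Finset.sum_nonneg fun j _ => hR _ j
    simpa [h3] using h2
  refine mem_closure_of_tendsto hlim ?_
  filter_upwards [eventually_gt_atTop 0] with n hn
  exact ch.reduced_mem_outerRegion (c n) hm hn hR (ch.noiseF A₀) hν hr fun A =>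
    Finset.single_le_sum (f := fun A => ch.errorProb (c n) A)
      (fun A _ => ch.errorProb_nonneg (c n) A) (Finset.mem_univ A)

theorem capacityRegion_subset_closure (hm : 2 ≤ m)
    (hnoise : ∀ A B : Receiver m, ch.noise A = ch.noise B) :
    ch.capacityRegion ⊆ closure ch.outerRegion :=
  closure_minimal (Set.iUnion_subset fun 𝓦 => closure_minimal
    (ch.achievable_subset_closure hm hnoise 𝓦) isClosed_closure) isClosed_closure

end AdditiveRAC

/-! ### Continuity of mutual information and closedness of the outer region -/

section Continuity

variable {α β κ : Type*} [Fintype α] [MeasurableSpace β] [TopologicalSpace κ]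
  [FirstCountableTopology κ]

/-- With a fixed reference law `μ`, the compensation identity writes the information as a linear
function of the input law minus the divergence of the output law from `μ`. The latter is continuous
by dominated convergence. -/
lemma continuous_toReal_mutualInfoNats (P : κ → PMF α)
    (hP : ∀ x, Continuous fun k => (P k x).toReal) (W : α → Measure β)
    [∀ x, IsProbabilityMeasure (W x)] :
    Continuous fun k => (mutualInfoNats (P k) W).toReal := by
  rcases isEmpty_or_nonempty α with hα | hα
  · have : IsEmpty κ := ⟨fun k => hα.elim (P k).support_nonempty.some⟩
    exact continuous_of_const fun k => this.elim k
  -- The uniform input charges every letter, so its output law dominates every `W x` with density at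
  -- most `|α|`.
  set u := PMF.uniformOfFintype α with hu
  have hu0 : ∀ x, u x ≠ 0 := fun x => by simp [hu]
  set μ := u.mixture W with hμ
  have hac : ∀ x, W x ≪ μ := fun x => u.absolutelyContinuous_mixture W (hu0 x)
  have hfin : ∀ x, klDiv (W x) μ ≠ ∞ := fun x => klDiv_mixture_ne_top u W (hu0 x)
  have hackμ : ∀ k, (P k).mixture W ≪ μ := fun k => by
    rw [(P k).mixture_eq_withDensity W μ fun x _ => hac x]
    exact withDensity_absolutelyContinuous _ _
  have hlt : ∀ᵐ y ∂μ, ∀ x, (W x).rnDeriv μ y < ∞ :=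
    ae_all_iff.2 fun x => Measure.rnDeriv_lt_top _ _
  have hkl : ∀ k, (klDiv ((P k).mixture W) μ).toReal =
      ∫ y, klFun (∑ x, (P k x).toReal * ((W x).rnDeriv μ y).toReal) ∂μ := by
    intro k
    rw [toReal_klDiv_eq_integral_klFun (hackμ k)]
    refine integral_congr_ae ?_
    filter_upwards [(P k).rnDeriv_mixture W μ fun x _ => hac x, hlt] with y h1 h2
    rw [h1, ENNReal.toReal_sum fun x _ => ENNReal.mul_ne_top ((P k).apply_ne_top x) (h2 x).ne]
    simp
  have heq : ∀ k, (mutualInfoNats (P k) W).toReal =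
      (∑ x, (P k x).toReal * (klDiv (W x) μ).toReal) -
        ∫ y, klFun (∑ x, (P k x).toReal * ((W x).rnDeriv μ y).toReal) ∂μ := by
    intro k
    have h := sum_mul_klDiv_eq (P k) W μ
    have hs : ∀ x, P k x * klDiv (W x) μ ≠ ∞ := fun x =>
      ENNReal.mul_ne_top ((P k).apply_ne_top x) (hfin x)
    have h1 : klDiv ((P k).mixture W) μ ≠ ∞ :=
      ne_top_of_le_ne_top (ENNReal.sum_ne_top.2 fun x _ => hs x) (h ▸ le_add_self)
    have h2 := congrArg ENNReal.toReal h
    rw [ENNReal.toReal_add (mutualInfoNats_ne_top _ _) h1, ENNReal.toReal_sum fun x _ => hs x,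
      hkl] at h2
    simp only [ENNReal.toReal_mul] at h2
    linarith
  simp only [heq]
  refine Continuous.sub (continuous_finsetSum _ fun x _ => (hP x).mul_const _) ?_
  obtain ⟨B, hB⟩ := exists_klFun_le (Fintype.card α)
  refine continuous_of_dominated (bound := fun _ => B) (fun k => ?_) (fun k => ?_)
    (integrable_const _) (ae_of_all _ fun y => ?_)
  · exact (measurable_klFun.comp (Finset.measurable_fun_sum _ fun x _ =>
      (Measure.measurable_rnDeriv _ _).ennreal_toReal.const_mul _)).aestronglyMeasurable
  · have h1 : ∀ᵐ y ∂μ, ∀ x, (W x).rnDeriv μ y ≤ (u x)⁻¹ :=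
      ae_all_iff.2 fun x => rnDeriv_le_of_le_smul (u.le_smul_mixture W (hu0 x))
    filter_upwards [h1] with y hy
    refine hB _ ⟨Finset.sum_nonneg fun x _ => by positivity, ?_⟩
    calc ∑ x, (P k x).toReal * ((W x).rnDeriv μ y).toReal
        ≤ ∑ x, (P k x).toReal * Fintype.card α := by
          refine Finset.sum_le_sum fun x _ => mul_le_mul_of_nonneg_left ?_ ENNReal.toReal_nonneg
          have := ENNReal.toReal_mono (ENNReal.inv_ne_top.2 (hu0 x)) (hy x)
          simpa [hu] using this
      _ = Fintype.card α := by rw [← Finset.sum_mul, PMF.sum_toReal, one_mul]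
  · exact continuous_klFun.comp (continuous_finsetSum _ fun x _ => (hP x).mul_const _)

end Continuity

/-! ### Input laws as points of compact simplices -/

section Simplex

variable {α : Type*} [Fintype α]

/-- The distribution given by a point of the standard simplex. -/
noncomputable def simplexPMF (v : stdSimplex ℝ α) : PMF α :=
  PMF.ofFintype (fun a => ENNReal.ofReal (v.1 a)) (by
    rw [← ENNReal.ofReal_sum_of_nonneg fun a _ => v.2.1 a, v.2.2, ENNReal.ofReal_one])

lemma simplexPMF_apply (v : stdSimplex ℝ α) (a : α) :
    simplexPMF v a = ENNReal.ofReal (v.1 a) := rfl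

lemma simplexPMF_toReal (v : stdSimplex ℝ α) (a : α) : (simplexPMF v a).toReal = v.1 a :=
  ENNReal.toReal_ofReal (v.2.1 a)

lemma simplexPMF_surjective : Function.Surjective (simplexPMF (α := α)) := fun p => by
  refine ⟨⟨fun a => (p a).toReal, fun a => ENNReal.toReal_nonneg, p.sum_toReal⟩, ?_⟩
  ext a
  rw [simplexPMF_apply, ENNReal.ofReal_toReal (p.apply_ne_top a)]

lemma continuous_stdSimplex_apply (a : α) : Continuous fun v : stdSimplex ℝ α => v.1 a :=
  (continuous_apply a).comp continuous_subtype_val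

end Simplex

/-! ### Closedness of the outer region for finite alphabets -/

namespace AdditiveRAC

variable {m : ℕ} {X : Fin m → Type*} {F Z : Type*}
  [Field F] [MeasurableSpace F] [MeasurableAdd F] [MeasurableSpace Z] (ch : AdditiveRAC X F Z)
  [∀ i, Fintype (X i)]

/-- Distributions of a time-sharing variable with `N` values and of the inputs given its value,
as points of standard simplices. -/
abbrev InputSimplex (X : Fin m → Type*) [∀ i, Fintype (X i)] (N : ℕ) : Type _ :=
  stdSimplex ℝ (Fin N) × (Fin N → ∀ i, stdSimplex ℝ (X i))

/-- `I(X_A; Y_A | Q)` as a function on the product of simplices. -/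
noncomputable def simplexInfo {N : ℕ} (A : Receiver m) (k : InputSimplex X N) : ℝ :=
  ∑ q, k.1.1 q * (ch.inputOutputInfo (prodPMF fun i => simplexPMF (k.2 q i)) A).toReal

lemma continuous_simplexInfo {N : ℕ} (A : Receiver m) :
    Continuous (ch.simplexInfo A (N := N)) := by
  refine continuous_finsetSum _ fun q _ =>
    ((continuous_stdSimplex_apply q).comp continuous_fst).mul ?_
  simp only [inputOutputInfo_eq, ENNReal.toReal_div]
  refine Continuous.div_const (continuous_toReal_mutualInfoNats _ (fun w => ?_) _) _
  simp only [prodPMF_apply, ENNReal.toReal_prod, simplexPMF_toReal]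
  refine continuous_finsetProd _ fun i _ => (continuous_stdSimplex_apply (w i)).comp ?_
  exact (continuous_apply i).comp ((continuous_apply q).comp continuous_snd)

lemma inputOutputInfo_prodPMF_ne_top (p : ∀ i, PMF (X i)) (A : Receiver m) :
    ch.inputOutputInfo (prodPMF p) A ≠ ∞ := by
  simpa only [PMF.map_id] using ch.inputOutputInfo_ne_top p (fun i => id) A

lemma condInputOutputInfo_simplexPMF {N : ℕ} (A : Receiver m) (k : InputSimplex X N) :
    ch.condInputOutputInfo (simplexPMF k.1) (fun q i => simplexPMF (k.2 q i)) A =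
      ENNReal.ofReal (ch.simplexInfo A k) := by
  rw [simplexInfo, ENNReal.ofReal_sum_of_nonneg fun q _ =>
    mul_nonneg (k.1.2.1 q) ENNReal.toReal_nonneg]
  refine Finset.sum_congr rfl fun q _ => ?_
  rw [ENNReal.ofReal_mul (k.1.2.1 q),
    ENNReal.ofReal_toReal (ch.inputOutputInfo_prodPMF_ne_top _ A)]
  rfl

/-- The rate tuples that satisfy the bounds on the sum rates for some time-sharing variable with
`N` values. -/
def sumRateRegion (N : ℕ) : Set (RateTuple m) :=
  {r | ∃ k : InputSimplex X N, ∀ (σ : Equiv.Perm (Fin m)) (K : Fin m),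
    ∑ k ∈ Finset.Iic K, r ⟨(σ k, (firstUsers σ k).1), mem_firstUsers σ k⟩ ≤
      ch.simplexInfo (firstUsers σ K) k}

/-- The region is the projection of a closed set along a compact factor. -/
lemma isClosed_sumRateRegion (N : ℕ) : IsClosed (ch.sumRateRegion N) := by
  have h : IsClosed {v : InputSimplex X N × RateTuple m | ∀ (σ : Equiv.Perm (Fin m)) (K : Fin m),
      ∑ k ∈ Finset.Iic K, v.2 ⟨(σ k, (firstUsers σ k).1), mem_firstUsers σ k⟩ ≤
        ch.simplexInfo (firstUsers σ K) v.1} := by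
    simp only [Set.ofPred_forall]
    refine isClosed_iInter fun σ => isClosed_iInter fun K => isClosed_le ?_
      ((ch.continuous_simplexInfo _).comp continuous_fst)
    exact continuous_finsetSum _ fun k _ => (continuous_apply _).comp continuous_snd
  have h2 := isClosedMap_snd_of_compactSpace _ h
  convert h2 using 1
  ext r
  simp [sumRateRegion]

/-- The unconditional bounds can be dropped by concavity, and the bound on the number of
time-sharing values leaves a finite union of closed sets. -/
lemma outerRegion_eq : ch.outerRegion = {r | (∀ p, 0 ≤ r p) ∧
    ∀ (i : Fin m) (A B : Finset (Fin m)) (hA : i ∈ A) (hAB : A ⊆ B),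
      r ⟨(i, B), hAB hA⟩ ≤ r ⟨(i, A), hA⟩} ∩ ⋃ N ∈ Set.Iic (m ! * m), ch.sumRateRegion N := by
  ext r
  simp only [outerRegion, sumRateRegion, Set.mem_inter_iff, Set.mem_iUnion, Set.mem_Iic,
    Set.mem_ofPred_eq, exists_prop, and_assoc]
  refine and_congr_right fun _ => and_congr_right fun _ => exists_congr fun N =>
    and_congr_right fun _ => ⟨?_, ?_⟩
  · rintro ⟨q, p, h⟩
    obtain ⟨v, rfl⟩ := simplexPMF_surjective q
    choose u hu using fun q i => simplexPMF_surjective (p q i)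
    obtain rfl : (fun q i => simplexPMF (u q i)) = p := by ext1 q; ext1 i; exact hu q i
    refine ⟨(v, u), fun σ K => ?_⟩
    have h1 := (h σ K).1
    rw [ch.condInputOutputInfo_simplexPMF _ (v, u), ENNReal.ofReal_le_ofReal_iff] at h1
    · exact h1
    · exact Finset.sum_nonneg fun q _ => mul_nonneg (v.2.1 q) ENNReal.toReal_nonneg
  · rintro ⟨k, h⟩
    refine ⟨simplexPMF k.1, fun q i => simplexPMF (k.2 q i), fun σ K => ?_⟩
    have h1 : ENNReal.ofReal (∑ k ∈ Finset.Iic K,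
        r ⟨(σ k, (firstUsers σ k).1), mem_firstUsers σ k⟩) ≤
        ch.condInputOutputInfo (simplexPMF k.1) (fun q i => simplexPMF (k.2 q i))
          (firstUsers σ K) := by
      rw [ch.condInputOutputInfo_simplexPMF]
      exact ENNReal.ofReal_le_ofReal (h σ K)
    refine ⟨h1, h1.trans ?_⟩
    simpa only [PMF.map_id] using ch.condInputOutputInfo_le (simplexPMF k.1)
      (fun q i => simplexPMF (k.2 q i)) (fun _ _ => id) (firstUsers σ K)

theorem isClosed_outerRegion : IsClosed ch.outerRegion := by
  rw [outerRegion_eq]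
  refine IsClosed.inter ?_ ((Set.finite_Iic _).isClosed_biUnion fun N _ =>
    ch.isClosed_sumRateRegion N)
  simp only [Set.ofPred_and, Set.ofPred_forall]
  refine IsClosed.inter (isClosed_iInter fun p => isClosed_le continuous_const (continuous_apply p))
    (isClosed_iInter fun i => isClosed_iInter fun A => isClosed_iInter fun B =>
      isClosed_iInter fun hA => isClosed_iInter fun hAB =>
        isClosed_le (continuous_apply _) (continuous_apply _))

end AdditiveRAC

theorem mainTheorem7 {m : ℕ} (hm : 2 ≤ m) {X : Fin m → Type*} {F Z : Type*}
    [Field F] [MeasurableSpace F] [MeasurableAdd F] [MeasurableSpace Z]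
    (ch : AdditiveRAC X F Z) (hnoise : ∀ A B : Receiver m, ch.noise A = ch.noise B) :
    ((∀ i, Finite (X i)) → ch.capacityRegion ⊆ ch.outerRegion) ∧
      ch.capacityRegion ⊆ closure ch.outerRegion := by
  refine ⟨fun hX => ?_, ch.capacityRegion_subset_closure hm hnoise⟩
  have := fun i => Fintype.ofFinite (X i)
  exact (ch.capacityRegion_subset_closure hm hnoise).trans ch.isClosed_outerRegion.closure_subset
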